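/- **Conventions.** Let $g\in\mathbb N$, $r\in\mathbb N_0$, $j\in\{1,\dots,g\}$, and write $a\vee b=\max\{a,b\}$. For $\underline\mu\in\mathbb C^g$ put $$\Phi_k^{(j)}(\underline\mu)=(-1)^k\sum_{\substack{1\le \ell_1<\dots<\ell_k\le g\\ \ell_m\ne j}}\mu_{\ell_1}\cdots\mu_{\ell_k}\quad(0\le k\le g),\qquad \Phi_0^{(j)}=1,\quad \Phi_g^{(j)}=0,$$ and for $\underline E=(E_0,\dots,E_N)\in\mathbb C^{N+1}$ let $c_k(\underline E)$ be the coefficient of $z^{-k}$ in $\prod_{m=0}^N(1-E_m/z)^{-1/2}$, i.e. $$c_k(\underline E)=\sum_{j_0+\dots+j_N=k}\frac{(2j_0-1)!!\cdots(2j_N-1)!!}{2^k\,j_0!\cdots j_N!}E_0^{j_0}\cdots E_N^{j_N}.$$ In each case below the potentials are stationary solutions of the $g$th equation of the hierarchy (the deformation time is a fixed parameter and is suppressed), and all functions on $\mathbb R$ are smooth and complex valued. A hat denotes homogeneous quantities (all integration constants of the recursion equal to zero): $\hat f_k,\hat g_k,\hat h_k$ are the universal polynomials in the potentials and their derivatives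 (shifts, for Toda) that solve the recursion, where each coefficient obtained by integration (summation) has zero constant term. Except for sGmKdV, $\widehat F_r(z)=\sum_{\ell=0}^r\hat f_{r-\ell}z^\ell$ and $\widehat H_r(z)=\sum_{\ell=0}^r\hat h_{r-\ell}z^\ell$, evaluated on the given solution. The points $\mu_j$, $\nu_j$ need not be distinct, nor need the $E_m$. **KdV.** Let $f_0=1$, $f_{k,x}=-\frac14f_{k-1,xxx}+Vf_{k-1,x}+\frac12V_xf_{k-1}$ for $k\in\mathbb N$ (arbitrary integration constants), $f_{g+1,x}=0$, $F_g=\sum_{k=0}^g f_{g-k}z^k=\prod_{l=1}^g(z-\mu_l(x))$, and $\frac12F_{g,xx}F_g-\frac14F_{g,x}^2-(V-z)F_g^2=\prod_{m=0}^{2g}(z-E_m)$ (the left-hand side does not depend on $x$). Then $$\widehat F_r(\mu_j)=\sum_{p=(r-g)\vee0}^{r}c_p(\underline E)\,\Phi^{(j)}_{r-p}(\underline\mu).\tag{1}$$ **Toda.** For $a,b:\mathbb Z\to\mathbb C$ and $u^\pm(n)=u(n\pm1)$ let $f_0=1$, $g_0=-c_1\in\mathbb C$, $2f_{k+1}+g_k+g_k^-+2bf_k=0$,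 $g_{k+1}-g_{k+1}^-+2(a^2f_k^+-(a^-)^2f_k^-)+b(g_k-g_k^-)=0$ for $k\in\mathbb N_0$, together with the stationary equations $g_g^++g_g+f_{g+1}^++f_{g+1}+2b^+f_g^+=0$ and $b(g_g+f_{g+1})+a^2f_g^+-(a^-)^2f_g^-+b^2f_g=0$. Let $F_g=\sum_{k=0}^gf_{g-k}z^k=\prod_{l=1}^g(z-\mu_l(n))$, $G_{g+1}=-z^{g+1}+\sum_{k=0}^gg_{g-k}z^k+f_{g+1}$ and $G_{g+1}^2-4a^2F_gF_g^+=\prod_{m=0}^{2g+1}(z-E_m)$ (independent of $n$). Then (1) holds. **AKNS.** Let $f_0=-iq$, $g_0=1$, $h_0=ip$, $f_{\ell+1}=\frac i2f_{\ell,x}-iqg_{\ell+1}$, $g_{\ell+1,x}=pf_\ell+qh_\ell$, $h_{\ell+1}=-\frac i2h_{\ell,x}+ipg_{\ell+1}$ for $\ell\in\mathbb N_0$, and $f_{g+1}=h_{g+1}=0$. Let $F_g=\sum_{\ell=0}^gf_{g-\ell}z^\ell=-iq\prod_{l=1}^g(z-\mu_l)$, $H_g=\sum_{\ell=0}^gh_{g-\ell}z^\ell=ip\prod_{l=1}^g(z-\nu_l)$,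 $G_{g+1}=\sum_{\ell=0}^{g+1}g_{g+1-\ell}z^\ell$, and $G_{g+1}^2-F_gH_g=\prod_{m=0}^{2g+1}(z-E_m)$ (independent of $x$). Then $$\widehat F_r(\mu_j)=-iq\sum_{p=(r-g)\vee0}^{r}c_p(\underline E)\Phi^{(j)}_{r-p}(\underline\mu),\qquad \widehat H_r(\nu_j)=ip\sum_{p=(r-g)\vee0}^{r}c_p(\underline E)\Phi^{(j)}_{r-p}(\underline\nu).$$ **sGmKdV.** Let $F_g=\sum_{k=0}^gf_{g-k}z^k=\prod_{l=1}^g(z-\mu_l)$ and $H_g=\sum_{k=0}^gh_{g-k}z^k=\prod_{l=1}^g(z-\nu_l)$ be monic of degree $g$ in $z$, and let $G_{g-1}$ be a polynomial of degree at most $g-1$ in $z$, with coefficients smooth in $x$, such that $f_g=\alpha e^{-iu}$, $h_g=\beta e^{iu}$ ($\alpha,\beta\in\mathbb C$) and, for all $z\ne0$, $-V_{g,x}+[U,V_g]=0$, where $$U=-i\begin{pmatrix}\frac12u_x&1\\z&-\frac12u_x\end{pmatrix},\qquad V_g=\begin{pmatrix}-G_{g-1}&\frac1zF_g\\H_g&G_{g-1}\end{pmatrix}.$$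 Let $z^2G_{g-1}^2+zF_gH_g=\prod_{m=0}^{2g}(z-E_m)$ (independent of $x$). For $k<r$ let $\hat f_k$ (resp. $\hat h_k$) be the homogeneous KdV coefficient $\hat f_k$ with $V$ replaced by $w_+$ (resp. $w_-$), $w_\pm=-\frac14(u_x^2\pm2iu_{xx})$, let $\hat f_r=\tilde\alpha e^{-iu}$, $\hat h_r=\tilde\beta e^{iu}$ with arbitrary $\tilde\alpha,\tilde\beta\in\mathbb C$, and let $\widehat F_r=\sum_{\ell=0}^r\hat f_{r-\ell}z^\ell$, $\widehat H_r=\sum_{\ell=0}^r\hat h_{r-\ell}z^\ell$. If $\alpha\neq0$, then $\mu_j\ne0$ and $$\frac{\widehat F_r(\mu_j)}{\mu_j}=\sum_{p=(r-1-g)\vee0}^{r-1}c_p(\underline E)\Phi^{(j)}_{r-1-p}(\underline\mu)-\frac{\tilde\alpha}{\alpha}\Phi^{(j)}_{g-1}(\underline\mu);$$ if $\beta\neq0$, then $\nu_j\ne0$ and $$\frac{\widehat H_r(\nu_j)}{\nu_j}=\sum_{p=(r-1-g)\vee0}^{r-1}c_p(\underline E)\Phi^{(j)}_{r-1-p}(\underline\nu)-\frac{\tilde\beta}{\beta}\Phi^{(j)}_{g-1}(\underline\nu).$$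 (For $r=0$ the sums over $p$ are empty.) -/

import Mathlib

open Polynomial Complex
open scoped ContDiff

noncomputable section

namespace Hierarchies

/-! ### Differential and difference polynomials, and the homogeneous coefficients -/

/-- The total derivative on polynomials in the jet variables indexed by `ι`: the derivation with
`X i ↦ X (s i)`, where `s i` is the index of the derivative of the variable `i`. -/
def totalDeriv {ι : Type} (s : ι → ι) :
    Derivation ℂ (MvPolynomial ι ℂ) (MvPolynomial ι ℂ) :=
  MvPolynomial.mkDerivation ℂ (fun i => MvPolynomial.X (s i))

/-- Differential polynomials in one function `V`: the variable `k` stands for `V^{(k)}`. -/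
abbrev DiffPoly := MvPolynomial ℕ ℂ

/-- `d/dx` on differential polynomials in `V`. -/
abbrev DiffPoly.D : Derivation ℂ DiffPoly DiffPoly := totalDeriv Nat.succ

/-- Differential polynomials in two functions `p`, `q`: `Sum.inl k` stands for `p^{(k)}` and
`Sum.inr k` for `q^{(k)}`. -/
abbrev DiffPoly₂ := MvPolynomial (ℕ ⊕ ℕ) ℂ

/-- `d/dx` on differential polynomials in `p`, `q`. -/
abbrev DiffPoly₂.D : Derivation ℂ DiffPoly₂ DiffPoly₂ := totalDeriv (Sum.map Nat.succ Nat.succ)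

/-- Polynomials in the shifts of two sequences `a`, `b` on `ℤ`: `Sum.inl k` stands for
`n ↦ a (n + k)` and `Sum.inr k` for `n ↦ b (n + k)`. -/
abbrev ShiftPoly := MvPolynomial (ℤ ⊕ ℤ) ℂ

/-- The shift by `m` on `ShiftPoly`; `S 1` is `S⁺` and `S (-1)` is `S⁻`. -/
def ShiftPoly.S (m : ℤ) : ShiftPoly →ₐ[ℂ] ShiftPoly :=
  MvPolynomial.rename (Sum.map (· + m) (· + m))

/-- The KdV recursion in the ring of differential polynomials, with all integration constants
equal to zero. -/
structure IsKdVHat (f : ℕ → DiffPoly) : Prop where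
  zero : f 0 = 1
  succ : ∀ j, DiffPoly.D (f (j + 1)) =
    MvPolynomial.C (-(1 / 4)) * DiffPoly.D (DiffPoly.D (DiffPoly.D (f j)))
      + MvPolynomial.X 0 * DiffPoly.D (f j)
      + MvPolynomial.C (1 / 2) * MvPolynomial.X 1 * f j
  const : ∀ j, MvPolynomial.constantCoeff (f (j + 1)) = 0

/-- The AKNS recursion in the ring of differential polynomials in `p`, `q`, with all integration
constants equal to zero. -/
structure IsAKNSHat (f g h : ℕ → DiffPoly₂) : Prop where
  f_zero : f 0 = MvPolynomial.C (-I) * MvPolynomial.X (Sum.inr 0)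
  g_zero : g 0 = 1
  h_zero : h 0 = MvPolynomial.C I * MvPolynomial.X (Sum.inl 0)
  f_succ : ∀ l, f (l + 1) = MvPolynomial.C (I / 2) * DiffPoly₂.D (f l)
    - MvPolynomial.C I * MvPolynomial.X (Sum.inr 0) * g (l + 1)
  g_succ : ∀ l, DiffPoly₂.D (g (l + 1)) =
    MvPolynomial.X (Sum.inl 0) * f l + MvPolynomial.X (Sum.inr 0) * h l
  h_succ : ∀ l, h (l + 1) = MvPolynomial.C (-(I / 2)) * DiffPoly₂.D (h l)
    + MvPolynomial.C I * MvPolynomial.X (Sum.inl 0) * g (l + 1)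
  g_const : ∀ l, MvPolynomial.constantCoeff (g (l + 1)) = 0

/-- The Toda recursion in the ring of polynomials in the shifts of `a`, `b`, with all integration
constants equal to zero. -/
structure IsTodaHat (f g : ℕ → ShiftPoly) : Prop where
  f_zero : f 0 = 1
  g_zero : g 0 = 0
  f_succ : ∀ j, 2 * f (j + 1) + g j + ShiftPoly.S (-1) (g j)
    + 2 * MvPolynomial.X (Sum.inr 0) * f j = 0
  g_succ : ∀ j, g (j + 1) - ShiftPoly.S (-1) (g (j + 1))
    + 2 * (MvPolynomial.X (Sum.inl 0) ^ 2 * ShiftPoly.S 1 (f j)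
      - MvPolynomial.X (Sum.inl (-1)) ^ 2 * ShiftPoly.S (-1) (f j))
    + MvPolynomial.X (Sum.inr 0) * (g j - ShiftPoly.S (-1) (g j)) = 0
  g_const : ∀ j, MvPolynomial.constantCoeff (g (j + 1)) = 0

/-! Existence of the homogeneous coefficients. -/

theorem exists_strong_rec {A : Type} (Φ : (ℕ → A) → ℕ → A) (a : A)
    (hΦ : ∀ f f' n, (∀ m < n, f m = f' m) → Φ f n = Φ f' n) : ∃ f : ℕ → A, ∀ n, f n = Φ f n := by
  let f : ℕ → A := fun n => Nat.strongRec (motive := fun _ => A)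
    (fun n ih => Φ (fun m => if h : m < n then ih m h else a) n) n
  refine ⟨f, fun n => ?_⟩
  have h1 : f n = Φ (fun m => if m < n then f m else a) n := by
    simp only [f]
    rw [Nat.strongRec]
    simp
  rw [h1]
  apply hΦ
  intro m hm
  simp [hm]

/-- A derivation applied to the coefficients of a power series. -/
def psD {A : Type} [CommRing A] [Algebra ℂ A] (D : Derivation ℂ A A) (F : PowerSeries A) :
    PowerSeries A := PowerSeries.mk fun n => D (PowerSeries.coeff n F)

section psD
variable {A : Type} [CommRing A] [Algebra ℂ A] (D : Derivation ℂ A A)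

theorem psD_coeff (F : PowerSeries A) (n : ℕ) :
    PowerSeries.coeff n (psD D F) = D (PowerSeries.coeff n F) := by simp [psD]

theorem psD_add (F G : PowerSeries A) : psD D (F + G) = psD D F + psD D G := by
  ext n; simp [psD]

theorem psD_sub (F G : PowerSeries A) : psD D (F - G) = psD D F - psD D G := by
  ext n; simp [psD]

theorem psD_mul (F G : PowerSeries A) : psD D (F * G) = F * psD D G + psD D F * G := by
  ext n
  simp only [psD_coeff, PowerSeries.coeff_mul, map_add, map_sum, Derivation.leibniz, smul_eq_mul,
    Finset.sum_add_distrib]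
  congr 1
  exact Finset.sum_congr rfl fun _ _ => mul_comm _ _

theorem psD_C (a : A) : psD D (PowerSeries.C a) = PowerSeries.C (D a) := by
  ext n
  rw [psD_coeff, PowerSeries.coeff_C, PowerSeries.coeff_C]
  split_ifs <;> simp

theorem psD_X : psD D (PowerSeries.X : PowerSeries A) = 0 := by
  ext n
  rw [psD_coeff, PowerSeries.coeff_X]
  split_ifs <;> simp

theorem psD_one : psD D (1 : PowerSeries A) = 0 := by
  have := psD_C D (1 : A)
  simpa using this

end psD

theorem constantCoeff_totalDeriv {ι : Type} (s : ι → ι) (P : MvPolynomial ι ℂ) :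
    MvPolynomial.constantCoeff (totalDeriv s P) = 0 := by
  induction P using MvPolynomial.induction_on with
  | C a => simp [totalDeriv]
  | add p q hp hq => simp [hp, hq]
  | mul_X p i hp => simp [totalDeriv] at hp ⊢

theorem derivation_ofNat {A : Type} [CommRing A] [Algebra ℂ A] (D : Derivation ℂ A A) (n : ℕ)
    [n.AtLeastTwo] : D (OfNat.ofNat n : A) = 0 := D.map_natCast n

theorem sum_antidiagonal_split {A : Type} [CommRing A] (f : ℕ → A) (m : ℕ) :
    ∑ ij ∈ Finset.HasAntidiagonal.antidiagonal (m + 1), f ij.1 * f ij.2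
      = 2 * f 0 * f (m + 1) + ∑ i ∈ Finset.range m, f (i + 1) * f (m - i) := by
  rw [Finset.Nat.sum_antidiagonal_eq_sum_range_succ_mk, Finset.sum_range_succ,
    Finset.sum_range_succ']
  have : ∀ i ∈ Finset.range m, f (i + 1) * f (m + 1 - (i + 1)) = f (i + 1) * f (m - i) := by
    intro i _
    rw [Nat.add_sub_add_right]
  simp only [Finset.sum_congr rfl this, Nat.sub_self, Nat.sub_zero]
  ring

theorem kdv_quad {A : Type} [CommRing A] [Algebra ℂ A] (D : Derivation ℂ A A) (V : A) :
    ∃ f : ℕ → A, f 0 = 1 ∧ ∀ m, 8 * f (m + 1) =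
      -(4 * ∑ i ∈ Finset.range m, f (i + 1) * f (m - i))
        - ∑ ij ∈ Finset.HasAntidiagonal.antidiagonal m,
          (2 * (f ij.1 * D (D (f ij.2))) - D (f ij.1) * D (f ij.2) - 4 * (V * (f ij.1 * f ij.2))) := by
  let Φ : (ℕ → A) → ℕ → A := fun f n => match n with
    | 0 => 1
    | m + 1 => (1 / 8 : ℂ) • (-(4 * ∑ i ∈ Finset.range m, f (i + 1) * f (m - i))
        - ∑ ij ∈ Finset.HasAntidiagonal.antidiagonal m,
          (2 * (f ij.1 * D (D (f ij.2))) - D (f ij.1) * D (f ij.2) - 4 * (V * (f ij.1 * f ij.2))))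
  obtain ⟨f, hf⟩ := exists_strong_rec Φ 0 (by
    intro f f' n h
    cases n with
    | zero => rfl
    | succ m =>
      simp only [Φ]
      congr 2
      · congr 2
        refine Finset.sum_congr rfl fun i hi => ?_
        have := Finset.mem_range.1 hi
        rw [h (i + 1) (by omega), h (m - i) (by omega)]
      · refine Finset.sum_congr rfl fun ij hij => ?_
        have := Finset.HasAntidiagonal.mem_antidiagonal.1 hij
        rw [h ij.1 (by omega), h ij.2 (by omega)])
  refine ⟨f, hf 0, fun m => ?_⟩
  rw [hf (m + 1)]
  simp only [Φ]
  rw [show (8 : A) = algebraMap ℂ A 8 from (map_ofNat _ _).symm, ← Algebra.smul_def, smul_smul]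
  norm_num

theorem kdv_lin {A : Type} [CommRing A] [Algebra ℂ A] [IsDomain A] (D : Derivation ℂ A A)
    (V : A) (f : ℕ → A) (f0 : f 0 = 1) (fs : ∀ m, 8 * f (m + 1) =
      -(4 * ∑ i ∈ Finset.range m, f (i + 1) * f (m - i))
        - ∑ ij ∈ Finset.HasAntidiagonal.antidiagonal m,
          (2 * (f ij.1 * D (D (f ij.2))) - D (f ij.1) * D (f ij.2) - 4 * (V * (f ij.1 * f ij.2))))
    (j : ℕ) : 4 * D (f (j + 1)) = -D (D (D (f j))) + 4 * (V * D (f j)) + 2 * (D V * f j) := by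
  obtain ⟨F, hFdef⟩ : ∃ F, F = PowerSeries.mk f := ⟨_, rfl⟩
  have k2 : (2 : PowerSeries A) = PowerSeries.C 2 := (map_ofNat _ _).symm
  have k4 : (4 : PowerSeries A) = PowerSeries.C 4 := (map_ofNat _ _).symm
  have dk4 : psD D (4 : PowerSeries A) = 0 := by rw [k4, psD_C, derivation_ofNat, map_zero]
  have dk2 : psD D (2 : PowerSeries A) = 0 := by rw [k2, psD_C, derivation_ofNat, map_zero]
  have hquad : 4 * (F * F) + PowerSeries.X * (2 * (F * psD D (psD D F)) - psD D F * psD D F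
      - 4 * (PowerSeries.C V * (F * F))) = 4 := by
    rw [k4, k2]
    ext1 n
    cases n with
    | zero => simp [hFdef, f0]
    | succ m =>
      rw [map_add, PowerSeries.coeff_succ_X_mul, PowerSeries.coeff_C_mul, PowerSeries.coeff_mul]
      simp only [hFdef, PowerSeries.coeff_mk]
      rw [sum_antidiagonal_split, f0]
      simp only [map_sub, PowerSeries.coeff_C_mul]
      simp only [PowerSeries.coeff_mul, psD_coeff,
        PowerSeries.coeff_mk]
      have h := fs m
      simp only [Finset.sum_sub_distrib, ← Finset.mul_sum] at h
      rw [PowerSeries.coeff_C, if_neg (by omega)]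
      linear_combination h
  have hF : F ≠ 0 := by
    intro h
    have := congrArg (PowerSeries.coeff 0) h
    simp [hFdef, f0] at this
  have h20 : (2 : PowerSeries A) ≠ 0 := by
    intro h
    have h' := congrArg (PowerSeries.coeff 0) h
    have : CharZero A := charZero_of_injective_algebraMap (algebraMap ℂ A).injective
    rw [k2] at h'
    simp at h'
  have hlin : 4 * psD D F = PowerSeries.X * (-psD D (psD D (psD D F))
      + 4 * (PowerSeries.C V * psD D F) + 2 * (PowerSeries.C (D V) * F)) := by
    have h := congrArg (psD D) hquad
    simp only [psD_add, psD_sub, psD_mul, psD_X, psD_C, dk4, dk2] at h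
    apply mul_left_cancel₀ (mul_ne_zero h20 hF)
    linear_combination h
  have := congrArg (PowerSeries.coeff (j + 1)) hlin
  rw [PowerSeries.coeff_succ_X_mul] at this
  rw [k4, k2] at this
  simpa [psD_coeff, hFdef, PowerSeries.coeff_C_mul] using this

theorem exists_isKdVHat : ∃ f, IsKdVHat f := by
  obtain ⟨f, f0, fs⟩ := kdv_quad DiffPoly.D (MvPolynomial.X 0)
  have h4 : (4 : DiffPoly) ≠ 0 := by norm_num
  have c4 : (4 : DiffPoly) = MvPolynomial.C 4 := (map_ofNat _ _).symm
  refine ⟨f, f0, fun j => ?_, fun j => ?_⟩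
  · have h := kdv_lin DiffPoly.D (MvPolynomial.X 0) f f0 fs j
    have hX : DiffPoly.D (MvPolynomial.X 0) = MvPolynomial.X 1 := by simp [totalDeriv]
    rw [hX] at h
    apply mul_left_cancel₀ h4
    rw [h]
    have e1 : (4 : DiffPoly) * MvPolynomial.C (-(1 / 4)) = -1 := by
      rw [c4, ← MvPolynomial.C_mul]; norm_num
    have e2 : (4 : DiffPoly) * MvPolynomial.C (1 / 2) = 2 := by
      rw [c4, ← MvPolynomial.C_mul, ← map_ofNat MvPolynomial.C 2]; norm_num
    linear_combination -DiffPoly.D (DiffPoly.D (DiffPoly.D (f j))) * e1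
      - MvPolynomial.X 1 * f j * e2
  · induction j using Nat.strong_induction_on with
    | _ j ih =>
      have h := congrArg MvPolynomial.constantCoeff (fs j)
      simp only [map_mul, map_sub, map_neg, map_sum, constantCoeff_totalDeriv,
        MvPolynomial.constantCoeff_X] at h
      rw [Finset.sum_eq_zero (s := Finset.range j)] at h
      · simpa [map_ofNat] using h
      · intro i hi
        have := Finset.mem_range.1 hi
        rw [ih i this, zero_mul]

theorem akns_seq {A : Type} [CommRing A] [Algebra ℂ A] (D : Derivation ℂ A A) (p q i : A) :
    ∃ f g h : ℕ → A, (f 0 = -i * q ∧ g 0 = 1 ∧ h 0 = i * p) ∧ ∀ l,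
      2 * f (l + 1) = i * D (f l) - 2 * i * q * g (l + 1) ∧
      2 * h (l + 1) = -i * D (h l) + 2 * i * p * g (l + 1) ∧
      2 * g (l + 1) = -(∑ k ∈ Finset.range l, g (k + 1) * g (l - k))
        + ∑ k ∈ Finset.range l, f k * h (l - 1 - k) := by
  let Γ : (ℕ → A × A × A) → ℕ → A := fun s l => (1 / 2 : ℂ) •
    (-(∑ k ∈ Finset.range l, (s (k + 1)).2.1 * (s (l - k)).2.1)
        + ∑ k ∈ Finset.range l, (s k).1 * (s (l - 1 - k)).2.2)
  let Φ : (ℕ → A × A × A) → ℕ → A × A × A := fun s n => match n with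
    | 0 => (-i * q, 1, i * p)
    | l + 1 => ((1 / 2 : ℂ) • (i * D (s l).1 - 2 * i * q * Γ s l), Γ s l,
        (1 / 2 : ℂ) • (-i * D (s l).2.2 + 2 * i * p * Γ s l))
  obtain ⟨s, hs⟩ := exists_strong_rec Φ 0 (by
    intro f f' n h
    cases n with
    | zero => rfl
    | succ m =>
      have hΓ : Γ f m = Γ f' m := by
        simp only [Γ]
        congr 2
        · congr 1
          refine Finset.sum_congr rfl fun i hi => ?_
          have := Finset.mem_range.1 hi
          rw [h (i + 1) (by omega), h (m - i) (by omega)]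
        · refine Finset.sum_congr rfl fun i hi => ?_
          have := Finset.mem_range.1 hi
          rw [h i (by omega), h (m - 1 - i) (by omega)]
      simp only [Φ, hΓ, h m (by omega)])
  have e : ∀ x : A, 2 * ((1 / 2 : ℂ) • x) = x := fun x => by
    rw [show (2 : A) = algebraMap ℂ A 2 from (map_ofNat _ _).symm, ← Algebra.smul_def, smul_smul]
    norm_num
  refine ⟨fun n => (s n).1, fun n => (s n).2.1, fun n => (s n).2.2,
    ⟨by simp only [hs 0, Φ], by simp only [hs 0, Φ], by simp only [hs 0, Φ]⟩, fun l => ⟨?_, ?_, ?_⟩⟩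
  · simp only [hs (l + 1), Φ, e]
  · simp only [hs (l + 1), Φ, e]
  · simp only [hs (l + 1), Φ]
    simp only [Γ, e]

theorem akns_lin {A : Type} [CommRing A] [Algebra ℂ A] [IsDomain A] (D : Derivation ℂ A A)
    (p q i : A) (hi : i * i = -1) (f g h : ℕ → A)
    (h0 : f 0 = -i * q ∧ g 0 = 1 ∧ h 0 = i * p) (hs : ∀ l,
      2 * f (l + 1) = i * D (f l) - 2 * i * q * g (l + 1) ∧
      2 * h (l + 1) = -i * D (h l) + 2 * i * p * g (l + 1) ∧
      2 * g (l + 1) = -(∑ k ∈ Finset.range l, g (k + 1) * g (l - k))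
        + ∑ k ∈ Finset.range l, f k * h (l - 1 - k)) (l : ℕ) :
    D (g (l + 1)) = p * f l + q * h l := by
  obtain ⟨F, hF⟩ : ∃ F, F = PowerSeries.mk f := ⟨_, rfl⟩
  obtain ⟨G, hG⟩ : ∃ G, G = PowerSeries.mk g := ⟨_, rfl⟩
  obtain ⟨H, hH⟩ : ∃ H, H = PowerSeries.mk h := ⟨_, rfl⟩
  have k2 : (2 : PowerSeries A) = PowerSeries.C 2 := (map_ofNat _ _).symm
  have hf : PowerSeries.X * psD D F = 2 * PowerSeries.C q * G - 2 * PowerSeries.C i * F := by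
    rw [k2]
    ext1 n
    cases n with
    | zero =>
      simp [hF, hG, mul_assoc, h0.1, h0.2.1]
      linear_combination -2 * q * hi
    | succ m =>
      simp [hF, hG, mul_assoc, psD_coeff, PowerSeries.coeff_succ_X_mul, PowerSeries.coeff_C_mul]
      linear_combination i * (hs m).1 + (D (f m) - 2 * q * g (m + 1)) * hi
  have hh : PowerSeries.X * psD D H = 2 * PowerSeries.C p * G + 2 * PowerSeries.C i * H := by
    rw [k2]
    ext1 n
    cases n with
    | zero =>
      simp [hH, hG, mul_assoc, h0.2.1, h0.2.2]
      linear_combination -2 * p * hi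
    | succ m =>
      simp [hH, hG, mul_assoc, psD_coeff, PowerSeries.coeff_succ_X_mul, PowerSeries.coeff_C_mul]
      linear_combination -i * (hs m).2.1 + (D (h m) - 2 * p * g (m + 1)) * hi
  have hquad : G * G - PowerSeries.X * (PowerSeries.X * (F * H)) = 1 := by
    ext1 n
    cases n with
    | zero => simp [hG, h0.2.1]
    | succ m =>
      rw [map_sub, PowerSeries.coeff_succ_X_mul, PowerSeries.coeff_mul]
      simp only [hG, PowerSeries.coeff_mk]
      rw [sum_antidiagonal_split, h0.2.1, PowerSeries.coeff_one, if_neg (by omega)]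
      have h3 := (hs m).2.2
      cases m with
      | zero => simp at h3 ⊢; exact h3
      | succ m =>
        rw [PowerSeries.coeff_succ_X_mul, PowerSeries.coeff_mul,
          Finset.Nat.sum_antidiagonal_eq_sum_range_succ_mk]
        simp only [hF, hH, PowerSeries.coeff_mk]
        simp only [Nat.add_sub_cancel] at h3
        linear_combination h3
  have h20 : (2 : PowerSeries A) ≠ 0 := by
    intro h
    have h' := congrArg (PowerSeries.coeff 0) h
    have : CharZero A := charZero_of_injective_algebraMap (algebraMap ℂ A).injective
    rw [k2] at h'
    simp at h'
  have hG0 : G ≠ 0 := by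
    intro h
    have := congrArg (PowerSeries.coeff 0) h
    simp [hG, h0.2.1] at this
  have hlin : psD D G = PowerSeries.X * (PowerSeries.C p * F + PowerSeries.C q * H) := by
    have h := congrArg (psD D) hquad
    simp only [psD_sub, psD_mul, psD_X, psD_one] at h
    apply mul_left_cancel₀ (mul_ne_zero h20 hG0)
    linear_combination h + PowerSeries.X * H * hf + PowerSeries.X * F * hh
  have := congrArg (PowerSeries.coeff (l + 1)) hlin
  rw [PowerSeries.coeff_succ_X_mul] at this
  simpa [psD_coeff, hF, hG, hH, PowerSeries.coeff_C_mul] using this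

theorem exists_isAKNSHat : ∃ f g h, IsAKNSHat f g h := by
  obtain ⟨f, g, h, h0, hs⟩ := akns_seq DiffPoly₂.D (MvPolynomial.X (Sum.inl 0))
    (MvPolynomial.X (Sum.inr 0)) (MvPolynomial.C I)
  have hl := akns_lin DiffPoly₂.D (MvPolynomial.X (Sum.inl 0))
    (MvPolynomial.X (Sum.inr 0)) (MvPolynomial.C I) (by rw [← MvPolynomial.C_mul]; simp)
    f g h h0 hs
  have h2 : (2 : DiffPoly₂) ≠ 0 := by norm_num
  have e : (2 : DiffPoly₂) * MvPolynomial.C (I / 2) = MvPolynomial.C I := by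
    rw [show (2 : DiffPoly₂) = MvPolynomial.C 2 from (map_ofNat _ _).symm, ← MvPolynomial.C_mul]
    congr 1; ring
  have hf : ∀ l, MvPolynomial.constantCoeff (f l) = 0 := by
    intro l
    cases l with
    | zero => simp [h0.1]
    | succ l =>
      have h := congrArg MvPolynomial.constantCoeff (hs l).1
      simpa [constantCoeff_totalDeriv, map_ofNat] using h
  refine ⟨f, g, h, ?_, h0.2.1, h0.2.2, fun l => ?_, hl, fun l => ?_, fun l => ?_⟩
  · rw [h0.1, map_neg]
  · apply mul_left_cancel₀ h2
    linear_combination (hs l).1 - DiffPoly₂.D (f l) * e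
  · apply mul_left_cancel₀ h2
    rw [map_neg]
    linear_combination (hs l).2.1 + DiffPoly₂.D (h l) * e
  · induction l using Nat.strong_induction_on with
    | _ l ih =>
      have h := congrArg MvPolynomial.constantCoeff (hs l).2.2
      simp only [map_mul, map_add, map_neg, map_sum, hf] at h
      rw [Finset.sum_eq_zero (s := Finset.range l)] at h
      · simpa [map_ofNat] using h
      · intro i hi
        have := Finset.mem_range.1 hi
        rw [ih i this, zero_mul]

theorem toda_seq {A : Type} [CommRing A] [Algebra ℂ A] (σ τ : A →+* A) (a b : A) :
    ∃ f g : ℕ → A, f 0 = 1 ∧ (∀ m, 2 * f (m + 1) = -(g m + σ (g m)) - 2 * b * f m) ∧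
      g 0 = 0 ∧ ∀ m, 2 * g (m + 1) = (∑ k ∈ Finset.range (m + 1), g k * g (m - k))
        - 4 * a ^ 2 * ∑ k ∈ Finset.range (m + 1), f k * τ (f (m - k)) := by
  let Φ : (ℕ → A × A) → ℕ → A × A := fun s n => match n with
    | 0 => (1, 0)
    | m + 1 => ((1 / 2 : ℂ) • (-((s m).2 + σ (s m).2) - 2 * b * (s m).1),
        (1 / 2 : ℂ) • ((∑ k ∈ Finset.range (m + 1), (s k).2 * (s (m - k)).2)
          - 4 * a ^ 2 * ∑ k ∈ Finset.range (m + 1), (s k).1 * τ (s (m - k)).1))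
  obtain ⟨s, hs⟩ := exists_strong_rec Φ 0 (by
    intro f f' n h
    cases n with
    | zero => rfl
    | succ m =>
      have h1 : ∀ k ∈ Finset.range (m + 1), f k = f' k ∧ f (m - k) = f' (m - k) := by
        intro k hk
        have := Finset.mem_range.1 hk
        exact ⟨h k (by omega), h (m - k) (by omega)⟩
      simp only [Φ, h m (by omega)]
      congr 3
      · exact Finset.sum_congr rfl fun k hk => by rw [(h1 k hk).1, (h1 k hk).2]
      · congr 1
        exact Finset.sum_congr rfl fun k hk => by rw [(h1 k hk).1, (h1 k hk).2])
  have e : ∀ x : A, 2 * ((1 / 2 : ℂ) • x) = x := fun x => by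
    rw [show (2 : A) = algebraMap ℂ A 2 from (map_ofNat _ _).symm, ← Algebra.smul_def, smul_smul]
    norm_num
  refine ⟨fun n => (s n).1, fun n => (s n).2, by simp only [hs 0, Φ], fun m => ?_,
    by simp only [hs 0, Φ], fun m => ?_⟩
  · simp only [hs (m + 1), Φ, e]
  · simp only [hs (m + 1), Φ, e]

theorem toda_lin {A : Type} [CommRing A] [Algebra ℂ A] [IsDomain A] (σ τ : A →+* A) (a b : A)
    (hστ : ∀ x, σ (τ x) = x) (f g : ℕ → A)
    (f0 : f 0 = 1) (hf : ∀ m, 2 * f (m + 1) = -(g m + σ (g m)) - 2 * b * f m)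
    (g0 : g 0 = 0) (hg : ∀ m, 2 * g (m + 1) = (∑ k ∈ Finset.range (m + 1), g k * g (m - k))
        - 4 * a ^ 2 * ∑ k ∈ Finset.range (m + 1), f k * τ (f (m - k))) (m : ℕ) :
    g (m + 1) - σ (g (m + 1)) + 2 * (a ^ 2 * τ (f m) - σ a ^ 2 * σ (f m))
      + b * (g m - σ (g m)) = 0 := by
  obtain ⟨F, hF⟩ : ∃ F, F = PowerSeries.mk f := ⟨_, rfl⟩
  obtain ⟨G, hG⟩ : ∃ G, G = PowerSeries.mk g := ⟨_, rfl⟩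
  have k2 : (2 : PowerSeries A) = PowerSeries.C 2 := (map_ofNat _ _).symm
  have hL : 2 * F + PowerSeries.X * (G + PowerSeries.map σ G + 2 * (PowerSeries.C b * F)) = 2 := by
    rw [k2]
    ext1 n
    cases n with
    | zero => simp [hF, f0]
    | succ m =>
      rw [map_add, PowerSeries.coeff_succ_X_mul]
      simp only [map_add, PowerSeries.coeff_C_mul, hF, hG, PowerSeries.coeff_mk,
        PowerSeries.coeff_map]
      rw [PowerSeries.coeff_C, if_neg (by omega)]
      linear_combination hf m
  have hQ : 2 * G = PowerSeries.X * (G * G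
      - PowerSeries.C (4 * a ^ 2) * (F * PowerSeries.map τ F)) := by
    rw [k2]
    ext1 n
    cases n with
    | zero => simp [hG, g0]
    | succ m =>
      rw [PowerSeries.coeff_succ_X_mul]
      simp only [map_sub, PowerSeries.coeff_C_mul]
      simp only [PowerSeries.coeff_mul, hF, hG, PowerSeries.coeff_mk, PowerSeries.coeff_map,
        Finset.Nat.sum_antidiagonal_eq_sum_range_succ_mk]
      exact hg m
  have hQ' : 2 * PowerSeries.map σ G = PowerSeries.X * (PowerSeries.map σ G * PowerSeries.map σ G
      - PowerSeries.C (4 * σ a ^ 2) * (PowerSeries.map σ F * F)) := by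
    have h := congrArg (PowerSeries.map σ) hQ
    have hinv : PowerSeries.map σ (PowerSeries.map τ F) = F := by
      ext n; simp [hστ]
    simpa [hinv, map_ofNat] using h
  have h20 : (2 : PowerSeries A) ≠ 0 := by
    intro h
    have h' := congrArg (PowerSeries.coeff 0) h
    have : CharZero A := charZero_of_injective_algebraMap (algebraMap ℂ A).injective
    rw [k2] at h'
    simp at h'
  have hF0 : F ≠ 0 := by
    intro h
    have := congrArg (PowerSeries.coeff 0) h
    simp [hF, f0] at this
  have hlin : G - PowerSeries.map σ G + PowerSeries.X * (2 * (PowerSeries.C (a ^ 2)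
      * PowerSeries.map τ F - PowerSeries.C (σ a ^ 2) * PowerSeries.map σ F)
      + PowerSeries.C b * (G - PowerSeries.map σ G)) = 0 := by
    have e1 : PowerSeries.C (4 * a ^ 2) = 4 * PowerSeries.C (a ^ 2) := by simp [map_ofNat]
    have e2 : PowerSeries.C (4 * σ a ^ 2) = 4 * PowerSeries.C (σ a ^ 2) := by simp [map_ofNat]
    rw [e1] at hQ
    rw [e2] at hQ'
    apply mul_left_cancel₀ (mul_ne_zero h20 hF0)
    linear_combination hQ - hQ' + (G - PowerSeries.map σ G) * hL
  have := congrArg (PowerSeries.coeff (m + 1)) hlin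
  rw [map_add, PowerSeries.coeff_succ_X_mul, k2] at this
  simp only [map_add, map_sub, PowerSeries.coeff_C_mul, hF, hG, PowerSeries.coeff_mk,
    PowerSeries.coeff_map, map_zero] at this
  linear_combination this

theorem exists_isTodaHat : ∃ f g, IsTodaHat f g := by
  obtain ⟨f, g, f0, hf, g0, hg⟩ := toda_seq (ShiftPoly.S (-1)).toRingHom
    (ShiftPoly.S 1).toRingHom (MvPolynomial.X (Sum.inl 0)) (MvPolynomial.X (Sum.inr 0))
  have hl := toda_lin (ShiftPoly.S (-1)).toRingHom
    (ShiftPoly.S 1).toRingHom (MvPolynomial.X (Sum.inl 0)) (MvPolynomial.X (Sum.inr 0))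
    (by
      intro x
      have hid : (fun k : ℤ => k + -1) ∘ (fun k : ℤ => k + 1) = id := by ext k; simp
      simp only [ShiftPoly.S, AlgHom.toRingHom_eq_coe, RingHom.coe_coe, MvPolynomial.rename_rename]
      rw [Sum.map_comp_map, hid, Sum.map_id_id, MvPolynomial.rename_id_apply]) f g f0 hf g0 hg
  have hX : ShiftPoly.S (-1) (MvPolynomial.X (Sum.inl 0)) = MvPolynomial.X (Sum.inl (-1)) := by
    simp [ShiftPoly.S]
  simp only [AlgHom.toRingHom_eq_coe, RingHom.coe_coe, hX] at hl hf
  refine ⟨f, g, f0, g0, fun j => ?_, hl, fun j => ?_⟩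
  · linear_combination hf j
  · have key : ∀ j, MvPolynomial.constantCoeff (g j) = 0 := by
      intro j
      induction j using Nat.strong_induction_on with
      | _ j ih =>
        cases j with
        | zero => simp [g0]
        | succ j =>
          have h := congrArg MvPolynomial.constantCoeff (hg j)
          simp only [map_mul, map_sub, map_sum, map_pow, MvPolynomial.constantCoeff_X] at h
          rw [Finset.sum_eq_zero (s := Finset.range (j + 1))] at h
          · simpa [map_ofNat] using h
          · intro i hi
            rw [ih i (by simpa using hi), zero_mul]
    exact key _

/-! The homogeneous coefficients (any two solutions of the normalized recursions agree, since only
constants have vanishing total derivative or are shift invariant). -/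

/-- The homogeneous KdV coefficients `f̂_j`. -/
def kdvHat : ℕ → DiffPoly := exists_isKdVHat.choose

/-- The homogeneous AKNS coefficients `f̂_l`. -/
def aknsHatF : ℕ → DiffPoly₂ := exists_isAKNSHat.choose

/-- The homogeneous AKNS coefficients `ĝ_l`. -/
def aknsHatG : ℕ → DiffPoly₂ := exists_isAKNSHat.choose_spec.choose

/-- The homogeneous AKNS coefficients `ĥ_l`. -/
def aknsHatH : ℕ → DiffPoly₂ := exists_isAKNSHat.choose_spec.choose_spec.choose

/-- The homogeneous Toda coefficients `f̂_j`. -/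
def todaHatF : ℕ → ShiftPoly := exists_isTodaHat.choose

/-- The homogeneous Toda coefficients `ĝ_j`. -/
def todaHatG : ℕ → ShiftPoly := exists_isTodaHat.choose_spec.choose

theorem kdvHat_spec : IsKdVHat kdvHat := exists_isKdVHat.choose_spec

theorem aknsHat_spec : IsAKNSHat aknsHatF aknsHatG aknsHatH :=
  exists_isAKNSHat.choose_spec.choose_spec.choose_spec

theorem todaHat_spec : IsTodaHat todaHatF todaHatG := exists_isTodaHat.choose_spec.choose_spec

/-- The value at `x` of a differential polynomial in `v`. -/
def evalJet (v : ℝ → ℂ) (x : ℝ) (P : DiffPoly) : ℂ :=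
  MvPolynomial.aeval (fun k => iteratedDeriv k v x) P

/-- The value at `x` of a differential polynomial in `p`, `q`. -/
def evalJet₂ (p q : ℝ → ℂ) (x : ℝ) (P : DiffPoly₂) : ℂ :=
  MvPolynomial.aeval (Sum.elim (fun k => iteratedDeriv k p x) (fun k => iteratedDeriv k q x)) P

/-- The value at `n` of a polynomial in the shifts of `a`, `b`. -/
def evalShift (a b : ℤ → ℂ) (n : ℤ) (P : ShiftPoly) : ℂ :=
  MvPolynomial.aeval (Sum.elim (fun k => a (n + k)) (fun k => b (n + k))) P

/-! ### Symmetric functions and the coefficients `c_k(E)` -/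

/-- `Φ_k^{(j)}(μ)`: `(-1)^k` times the elementary symmetric function of degree `k` of the `μ_l`,
`l ≠ j` (in particular it vanishes for `k = g`). -/
def Phi {g : ℕ} (k : ℕ) (j : Fin g) (μ : Fin g → ℂ) : ℂ :=
  (-1) ^ k * ∑ s ∈ (Finset.univ.erase j).powersetCard k, ∏ l ∈ s, μ l

/-- The coefficient of `z^{-k}` in `∏_m (1 - E_m / z)^{-1/2}`. -/
def cCoeff {M : ℕ} (k : ℕ) (E : Fin M → ℂ) : ℂ :=
  ∑ j ∈ Finset.piAntidiag (Finset.univ : Finset (Fin M)) k,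
    (∏ m, (Nat.doubleFactorial (2 * j m - 1) : ℂ)) / (2 ^ k * ∏ m, (Nat.factorial (j m) : ℂ))
      * ∏ m, E m ^ j m

/-- The polynomial `∑_{l=0}^{n} f_{n-l} z^l`. -/
def coeffPoly (f : ℕ → ℂ) (n : ℕ) : ℂ[X] := ∑ l ∈ Finset.range (n + 1), C (f (n - l)) * X ^ l

/-! ### KdV -/

/-- `(f_j)` solves the KdV recursion for `V`, with arbitrary integration constants, and `V` is a
stationary solution of the `g`th KdV equation belonging to these constants: `f_{g+1,x} = 0`. -/
structure IsStationaryKdV (g : ℕ) (V : ℝ → ℂ) (f : ℕ → ℝ → ℂ) : Prop where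
  smooth_V : ContDiff ℝ ∞ V
  smooth : ∀ j, ContDiff ℝ ∞ (f j)
  zero : ∀ x, f 0 x = 1
  succ : ∀ j x, deriv (f (j + 1)) x = -(1 / 4) * iteratedDeriv 3 (f j) x
    + V x * deriv (f j) x + 1 / 2 * deriv V x * f j x
  stationary : ∀ x, deriv (f (g + 1)) x = 0

/-- The polynomial `F_g(z, x)`. -/
def kdvF (g : ℕ) (f : ℕ → ℝ → ℂ) (x : ℝ) : ℂ[X] := coeffPoly (fun j => f j x) g

/-- `½ F_{g,xx} F_g - ¼ F_{g,x}² - (V - z) F_g²`, which for stationary solutions does not depend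
on `x` and equals `R_{2g+1}(z)`. -/
def kdvR (g : ℕ) (V : ℝ → ℂ) (f : ℕ → ℝ → ℂ) (x : ℝ) : ℂ[X] :=
  C (1 / 2) * coeffPoly (fun j => iteratedDeriv 2 (f j) x) g * kdvF g f x
    - C (1 / 4) * coeffPoly (fun j => deriv (f j) x) g ^ 2
    - (C (V x) - X) * kdvF g f x ^ 2

/-- `F̂_r(z, x)` for KdV. -/
def kdvFHat (V : ℝ → ℂ) (r : ℕ) (x : ℝ) : ℂ[X] := coeffPoly (fun j => evalJet V x (kdvHat j)) r

/-! ### Toda -/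

/-- `(f_j)`, `(γ_j)` solve the Toda recursion for `a`, `b`, with arbitrary integration constants,
and `(a, b)` is a stationary solution of the `g`th Toda equation belonging to these constants. -/
structure IsStationaryToda (g : ℕ) (a b : ℤ → ℂ) (f γ : ℕ → ℤ → ℂ) : Prop where
  f_zero : ∀ n, f 0 n = 1
  g_zero : ∃ c₁ : ℂ, ∀ n, γ 0 n = -c₁
  f_succ : ∀ j n, 2 * f (j + 1) n + γ j n + γ j (n - 1) + 2 * b n * f j n = 0
  g_succ : ∀ j n, γ (j + 1) n - γ (j + 1) (n - 1)
    + 2 * (a n ^ 2 * f j (n + 1) - a (n - 1) ^ 2 * f j (n - 1))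
    + b n * (γ j n - γ j (n - 1)) = 0
  stationary₁ : ∀ n, γ g (n + 1) + γ g n + f (g + 1) (n + 1) + f (g + 1) n
    + 2 * b (n + 1) * f g (n + 1) = 0
  stationary₂ : ∀ n, b n * (γ g n + f (g + 1) n) + a n ^ 2 * f g (n + 1)
    - a (n - 1) ^ 2 * f g (n - 1) + b n ^ 2 * f g n = 0

/-- The polynomial `F_g(z, n)`. -/
def todaF (g : ℕ) (f : ℕ → ℤ → ℂ) (n : ℤ) : ℂ[X] := coeffPoly (fun j => f j n) g

/-- The polynomial `G_{g+1}(z, n)`. -/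
def todaG (g : ℕ) (f γ : ℕ → ℤ → ℂ) (n : ℤ) : ℂ[X] :=
  -X ^ (g + 1) + coeffPoly (fun j => γ j n) g + C (f (g + 1) n)

/-- `G_{g+1}² - 4 a² F_g F_g⁺`, which for stationary solutions does not depend on `n` and equals
`R_{2g+2}(z)`. -/
def todaR (g : ℕ) (a : ℤ → ℂ) (f γ : ℕ → ℤ → ℂ) (n : ℤ) : ℂ[X] :=
  todaG g f γ n ^ 2 - C (4 * a n ^ 2) * todaF g f n * todaF g f (n + 1)

/-- `F̂_r(z, n)` for Toda. -/
def todaFHat (a b : ℤ → ℂ) (r : ℕ) (n : ℤ) : ℂ[X] :=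
  coeffPoly (fun j => evalShift a b n (todaHatF j)) r

/-! ### AKNS -/

/-- `(f_l)`, `(γ_l)`, `(h_l)` solve the AKNS recursion for `p`, `q`, with arbitrary integration
constants, and `(p, q)` is a stationary solution of the `g`th AKNS equation belonging to these
constants: `f_{g+1} = h_{g+1} = 0`. -/
structure IsStationaryAKNS (g : ℕ) (p q : ℝ → ℂ) (f γ h : ℕ → ℝ → ℂ) : Prop where
  smooth_p : ContDiff ℝ ∞ p
  smooth_q : ContDiff ℝ ∞ q
  smooth_f : ∀ l, ContDiff ℝ ∞ (f l)
  smooth_g : ∀ l, ContDiff ℝ ∞ (γ l)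
  smooth_h : ∀ l, ContDiff ℝ ∞ (h l)
  f_zero : ∀ x, f 0 x = -I * q x
  g_zero : ∀ x, γ 0 x = 1
  h_zero : ∀ x, h 0 x = I * p x
  f_succ : ∀ l x, f (l + 1) x = I / 2 * deriv (f l) x - I * q x * γ (l + 1) x
  g_succ : ∀ l x, deriv (γ (l + 1)) x = p x * f l x + q x * h l x
  h_succ : ∀ l x, h (l + 1) x = -(I / 2) * deriv (h l) x + I * p x * γ (l + 1) x
  stationary_f : ∀ x, f (g + 1) x = 0
  stationary_h : ∀ x, h (g + 1) x = 0

/-- The polynomial `F_g(z, x)`; the same expression gives `H_g(z, x)` from `(h_l)`. -/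
def aknsF (g : ℕ) (f : ℕ → ℝ → ℂ) (x : ℝ) : ℂ[X] := coeffPoly (fun l => f l x) g

/-- `G_{g+1}² - F_g H_g`, which for stationary solutions does not depend on `x` and equals
`R_{2g+2}(z)`. -/
def aknsR (g : ℕ) (f γ h : ℕ → ℝ → ℂ) (x : ℝ) : ℂ[X] :=
  coeffPoly (fun l => γ l x) (g + 1) ^ 2 - aknsF g f x * aknsF g h x

/-- `F̂_r(z, x)` for AKNS. -/
def aknsFHat (p q : ℝ → ℂ) (r : ℕ) (x : ℝ) : ℂ[X] :=
  coeffPoly (fun l => evalJet₂ p q x (aknsHatF l)) r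

/-- `Ĥ_r(z, x)` for AKNS. -/
def aknsHHat (p q : ℝ → ℂ) (r : ℕ) (x : ℝ) : ℂ[X] :=
  coeffPoly (fun l => evalJet₂ p q x (aknsHatH l)) r

/-! ### The combined sine-Gordon and mKdV hierarchy -/

/-- The polynomial `F_g(z, x)`; the same expression gives `H_g(z, x)` from `(h_j)`. -/
def sgF (g : ℕ) (f : ℕ → ℝ → ℂ) (x : ℝ) : ℂ[X] := coeffPoly (fun j => f j x) g

/-- The polynomial `G_{g-1}(z, x) = ∑_{l=0}^{g-1} γ_{g-1-l}(x) z^l`, with `G_{-1} = 0`. -/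
def sgG (g : ℕ) (γ : ℕ → ℝ → ℂ) (x : ℝ) : ℂ[X] :=
  ∑ l ∈ Finset.range g, C (γ (g - 1 - l) x) * X ^ l

/-- The matrix `U(z, x)`. -/
def sgMatU (u : ℝ → ℂ) (z : ℂ) (x : ℝ) : Matrix (Fin 2) (Fin 2) ℂ :=
  (-I) • !![deriv u x / 2, 1; z, -(deriv u x / 2)]

/-- The matrix `V_g(z, x)`. -/
def sgMatV (g : ℕ) (f h γ : ℕ → ℝ → ℂ) (z : ℂ) (x : ℝ) : Matrix (Fin 2) (Fin 2) ℂ :=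
  !![-((sgG g γ x).eval z), 1 / z * (sgF g f x).eval z;
    (sgF g h x).eval z, (sgG g γ x).eval z]

/-- `u` is a stationary solution of the `g`th sGmKdV equation, in zero curvature form
`-V_{g,x} + [U, V_g] = 0` with monic `F_g`, `H_g`, where `f_g = α e^{-iu}` and
`h_g = β e^{iu}`. -/
structure IsStationarySG (g : ℕ) (u : ℝ → ℂ) (α β : ℂ) (f h γ : ℕ → ℝ → ℂ) : Prop where
  smooth_u : ContDiff ℝ ∞ u
  smooth_f : ∀ j, ContDiff ℝ ∞ (f j)
  smooth_h : ∀ j, ContDiff ℝ ∞ (h j)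
  smooth_g : ∀ j, ContDiff ℝ ∞ (γ j)
  f_zero : ∀ x, f 0 x = 1
  h_zero : ∀ x, h 0 x = 1
  f_last : ∀ x, f g x = α * exp (-I * u x)
  h_last : ∀ x, h g x = β * exp (I * u x)
  zero_curvature : ∀ z : ℂ, z ≠ 0 → ∀ x : ℝ,
    -(Matrix.of fun i k => deriv (fun y => sgMatV g f h γ z y i k) x)
      + (sgMatU u z x * sgMatV g f h γ z x - sgMatV g f h γ z x * sgMatU u z x) = 0

/-- `z² G_{g-1}² + z F_g H_g`, which for stationary solutions does not depend on `x` and equals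
`R_{2g+1}(z)`. -/
def sgR (g : ℕ) (f h γ : ℕ → ℝ → ℂ) (x : ℝ) : ℂ[X] :=
  X ^ 2 * sgG g γ x ^ 2 + X * sgF g f x * sgF g h x

/-- `w_+ = -¼ (u_x² + 2 i u_{xx})`. -/
def wPlus (u : ℝ → ℂ) (x : ℝ) : ℂ := -(1 / 4) * (deriv u x ^ 2 + 2 * I * iteratedDeriv 2 u x)

/-- `w_- = -¼ (u_x² - 2 i u_{xx})`. -/
def wMinus (u : ℝ → ℂ) (x : ℝ) : ℂ := -(1 / 4) * (deriv u x ^ 2 - 2 * I * iteratedDeriv 2 u x)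

/-- `F̂_r(z, x)` for sGmKdV: `f̂_k` is the homogeneous KdV coefficient with `V` replaced by `w_+`
for `k < r`, and `f̂_r = α' e^{-iu}`. -/
def sgFHat (u : ℝ → ℂ) (α' : ℂ) (r : ℕ) (x : ℝ) : ℂ[X] :=
  coeffPoly (fun k => if k = r then α' * exp (-I * u x) else evalJet (wPlus u) x (kdvHat k)) r

/-- `Ĥ_r(z, x)` for sGmKdV: `ĥ_k` is the homogeneous KdV coefficient with `V` replaced by `w_-`
for `k < r`, and `ĥ_r = β' e^{iu}`. -/
def sgHHat (u : ℝ → ℂ) (β' : ℂ) (r : ℕ) (x : ℝ) : ℂ[X] :=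
  coeffPoly (fun k => if k = r then β' * exp (I * u x) else evalJet (wMinus u) x (kdvHat k)) r

end Hierarchies

end

/-!
With `w = 1 / z`, all four formulas follow from one identity between generating series: if
`F(w) = w^g F_g(1/w) = ∑_{k ≤ g} f_k w^k` comes from the stationary solution, then the series of
the homogeneous coefficients is
`∑_k f̂_k w^k = ∏_m (1 - E_m w)^{-1/2} · F(w)`.
Since `F(w)` is a constant times `∏_l (1 - μ_l w)` and `F̂_r(μ_j)` is the `r`th coefficient of
`(1 - μ_j w)⁻¹ ∑_k f̂_k w^k`, the factor belonging to `μ_j` cancels, and what remains is the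
convolution of the coefficients `c_p(E)` of the inverse square root (`cSeries_sq`) with those of
`∏_{l ≠ j} (1 - μ_l w)`, which are the `Φ_k^{(j)}(μ)` (`coeff_branchSeries_erase`). This is
`eval_coeffPoly`.

The identity itself comes from the quadratic first integral of each recursion (`kdvForm`,
`aknsForm`, `todaForm`). On a stationary solution the first integral is constant, hence equal to
`∏ (1 - E_m w)` up to normalization; the linear recursion makes its derivative, or the
difference with its shift, vanish. For the homogeneous coefficients the same computation takes
place in the ring of differential or shift polynomials, where only constants are killed by the total derivative
(`eq_C_of_totalDeriv_eq_zero`) or are shift invariant (`ShiftPoly.eq_C`); there the first integral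
is a constant, and the vanishing integration constants make it the trivial one (`kdvForm_kdvHat`,
`aknsForm_hat`, `todaForm_hat`). Multiplying the stationary series by the constant series
`∏ (1 - E_m w)^{-1/2}` rescales its first integral to the trivial one, and a first integral
determines the normalized series coefficient by coefficient (`kdvForm_injective`,
`IsAKNSSeries.unique`, `IsTodaSeries.unique`), so the two series agree.

For sGmKdV, eliminating `G` and `H` from the zero curvature equation shows that `F` satisfies the
quadratic KdV equation with potential `w_+` (`kdvForm_eq_sgForm`), and `H` the one with `w_-` by
the symmetry `sg_flip`; the exceptional last coefficient `α' e^{-iu} = (α'/α) f_g` is expressed by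
the product of the `μ_l`.

Power series over the differential algebra `SmoothFun` of smooth functions, respectively over
`ℤ → ℂ`, encode these identities for all `x` (or `n`) at once.
-/

noncomputable section

namespace Hierarchies

/-! ### The series `∏ (1 - E_m w)^{-1/2}` -/

/-- The power series of `(1 - w)^{-1/2}`, with coefficients `(2k-1)!! / (2^k k!)`. -/
def invSqrtSeries : PowerSeries ℂ :=
  PowerSeries.mk fun k => (Nat.doubleFactorial (2 * k - 1) : ℂ) / (2 ^ k * (Nat.factorial k : ℂ))

theorem invSqrtSeries_coeff_succ (k : ℕ) :
    2 * ((k : ℂ) + 1) * PowerSeries.coeff (k + 1) invSqrtSeries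
      = (2 * k + 1) * PowerSeries.coeff k invSqrtSeries := by
  have h : Nat.doubleFactorial (2 * (k + 1) - 1)
      = (2 * k + 1) * Nat.doubleFactorial (2 * k - 1) := by
    cases k with
    | zero => simp
    | succ k =>
      rw [show 2 * (k + 1 + 1) - 1 = (2 * k + 1) + 2 by omega, Nat.doubleFactorial_add_two,
        show 2 * (k + 1) - 1 = 2 * k + 1 by omega]
      ring
  simp only [invSqrtSeries, PowerSeries.coeff_mk, h, Nat.factorial_succ]
  have h1 : (Nat.factorial k : ℂ) ≠ 0 := by exact_mod_cast Nat.factorial_ne_zero k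
  have h2 : (k : ℂ) + 1 ≠ 0 := by exact_mod_cast Nat.succ_ne_zero k
  push_cast
  field_simp
  ring

/-- The series `y` of `(1 - w)^{-1/2}` solves `2 (1 - w) y' = y`, so `y² (1 - w)` has derivative
zero. -/
theorem invSqrtSeries_sq : invSqrtSeries ^ 2 * (1 - PowerSeries.X) = 1 := by
  have k2 : (2 : PowerSeries ℂ) = PowerSeries.C 2 := (map_ofNat _ _).symm
  have ode : 2 * (1 - PowerSeries.X) * PowerSeries.derivative ℂ invSqrtSeries = invSqrtSeries := by
    ext n
    rw [mul_assoc, k2, PowerSeries.coeff_C_mul, sub_mul, one_mul, map_sub]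
    cases n with
    | zero =>
      have h := invSqrtSeries_coeff_succ 0
      simp [PowerSeries.coeff_derivative] at h ⊢
      simpa using h
    | succ n =>
      rw [PowerSeries.coeff_succ_X_mul]
      have h := invSqrtSeries_coeff_succ (n + 1)
      simp only [PowerSeries.coeff_derivative]
      push_cast at h ⊢
      linear_combination h
  apply PowerSeries.derivative.ext
  · simp only [Derivation.leibniz, pow_two, smul_eq_mul, map_sub, Derivation.map_one_eq_zero,
      PowerSeries.derivative_X]
    linear_combination invSqrtSeries * ode
  · simp [invSqrtSeries, PowerSeries.constantCoeff_mk]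

/-- The series `∑ c_k(E) w^k`. -/
def cSeries {M : ℕ} (E : Fin M → ℂ) : PowerSeries ℂ := PowerSeries.mk fun k => cCoeff k E

theorem cSeries_eq_prod {M : ℕ} (E : Fin M → ℂ) :
    cSeries E = ∏ m, PowerSeries.rescale (E m) invSqrtSeries := by
  ext k
  rw [PowerSeries.coeff_prod, cSeries, PowerSeries.coeff_mk, cCoeff]
  have key : ∀ j ∈ Finset.piAntidiag (Finset.univ : Finset (Fin M)) k,
      (∏ m, (Nat.doubleFactorial (2 * j m - 1) : ℂ)) / (2 ^ k * ∏ m, (Nat.factorial (j m) : ℂ))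
        * ∏ m, E m ^ j m
      = ∏ m, PowerSeries.coeff (j m) (PowerSeries.rescale (E m) invSqrtSeries) := by
    intro j hj
    have hk := (Finset.mem_piAntidiag.1 hj).1
    simp only [PowerSeries.coeff_rescale, invSqrtSeries, PowerSeries.coeff_mk,
      Finset.prod_mul_distrib, Finset.prod_div_distrib, Finset.prod_pow_eq_pow_sum, ← hk]
    ring
  rw [Finset.sum_congr rfl key]
  refine Finset.sum_bij' (fun j _ => Finsupp.equivFunOnFinite.symm j) (fun j _ => ⇑j) ?_ ?_ ?_ ?_ ?_
  · intro j hj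
    rw [Finset.mem_finsuppAntidiag]
    exact ⟨by simpa using (Finset.mem_piAntidiag.1 hj).1, by simp⟩
  · intro j hj
    rw [Finset.mem_finsuppAntidiag] at hj
    rw [Finset.mem_piAntidiag]
    exact ⟨hj.1, by simp⟩
  · intro j _; simp
  · intro j _; simp
  · intro j _; simp

/-- The series `∏ (1 - E_m w)`. -/
def branchSeries {ι : Type} (s : Finset ι) (E : ι → ℂ) : PowerSeries ℂ :=
  ∏ m ∈ s, (1 - PowerSeries.C (E m) * PowerSeries.X)

theorem cSeries_sq {M : ℕ} (E : Fin M → ℂ) :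
    cSeries E ^ 2 * branchSeries Finset.univ E = 1 := by
  rw [cSeries_eq_prod, branchSeries, ← Finset.prod_pow, ← Finset.prod_mul_distrib]
  refine Finset.prod_eq_one fun m _ => ?_
  have h := congrArg (PowerSeries.rescale (E m)) invSqrtSeries_sq
  rwa [map_mul, map_pow, map_sub, map_one, PowerSeries.rescale_X] at h

theorem cCoeff_zero {M : ℕ} (E : Fin M → ℂ) : cCoeff 0 E = 1 := by
  simp [cCoeff]

theorem constantCoeff_cSeries {M : ℕ} (E : Fin M → ℂ) :
    PowerSeries.constantCoeff (cSeries E) = 1 := by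
  rw [cSeries, ← PowerSeries.coeff_zero_eq_constantCoeff_apply, PowerSeries.coeff_mk, cCoeff_zero]

/-! ### The symmetric functions `Φ_k^{(j)}` and evaluation at `μ_j` -/

theorem coeff_branchSeries_erase {g : ℕ} (j : Fin g) (μ : Fin g → ℂ) (n : ℕ) :
    PowerSeries.coeff n (branchSeries (Finset.univ.erase j) μ) = Phi n j μ := by
  have e : branchSeries (Finset.univ.erase j) μ
      = ∑ t ∈ (Finset.univ.erase j).powerset,
        PowerSeries.C ((-1) ^ t.card * ∏ l ∈ t, μ l) * PowerSeries.X ^ t.card := by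
    simp only [branchSeries, sub_eq_add_neg, Finset.prod_one_add]
    refine Finset.sum_congr rfl fun t _ => ?_
    rw [map_mul, map_prod, map_pow, map_neg, map_one, ← Finset.prod_const, ← Finset.prod_const,
      ← Finset.prod_mul_distrib, ← Finset.prod_mul_distrib]
    exact Finset.prod_congr rfl fun _ _ => by ring
  rw [e, map_sum, Phi, Finset.powersetCard_eq_filter, Finset.mul_sum, Finset.sum_filter]
  refine Finset.sum_congr rfl fun t _ => ?_
  rw [PowerSeries.coeff_C_mul, PowerSeries.coeff_X_pow]
  by_cases h : t.card = n
  · simp [h]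
  · simp [h, Ne.symm h]

theorem Phi_eq_zero {g k : ℕ} (j : Fin g) (μ : Fin g → ℂ) (h : g ≤ k) : Phi k j μ = 0 := by
  have hg : 0 < g := j.pos
  rw [Phi, Finset.powersetCard_eq_empty.2, Finset.sum_empty, mul_zero]
  rw [Finset.card_erase_of_mem (Finset.mem_univ _), Finset.card_univ, Fintype.card_fin]
  omega

/-- `Φ_{g-1}^{(j)}` is up to sign the product of all `μ_l` with `l ≠ j`. -/
theorem Phi_pred {g : ℕ} (j : Fin g) (μ : Fin g → ℂ) :
    Phi (g - 1) j μ = (-1) ^ (g - 1) * ∏ l ∈ Finset.univ.erase j, μ l := by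
  have : g - 1 = (Finset.univ.erase j).card := by
    rw [Finset.card_erase_of_mem (Finset.mem_univ _), Finset.card_univ, Fintype.card_fin]
  rw [Phi]
  conv_lhs => rw [this]
  rw [Finset.powersetCard_self, Finset.sum_singleton, ← this]

/-- If the generating series of `φ` is `c(w) s ∏_l (1 - μ_l w)`, then the polynomial with
coefficients `φ` takes at `μ_j` the value predicted by dividing out the factor `1 - μ_j w`. -/
theorem eval_coeffPoly {g M : ℕ} (r : ℕ) (j : Fin g) (E : Fin M → ℂ) (μ : Fin g → ℂ) (s : ℂ)
    (φ : ℕ → ℂ)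
    (hφ : PowerSeries.mk φ = cSeries E * (PowerSeries.C s * branchSeries Finset.univ μ)) :
    (coeffPoly φ r).eval (μ j)
      = s * ∑ p ∈ Finset.Icc (r - g) r, cCoeff p E * Phi (r - p) j μ := by
  -- Multiplying by the geometric series of `μ_j` turns evaluation at `μ_j` into a coefficient.
  have hgeom : (1 - PowerSeries.C (μ j) * PowerSeries.X)
      * PowerSeries.mk (fun k => μ j ^ k) = 1 := by
    ext n
    rw [sub_mul, one_mul, mul_assoc, map_sub, PowerSeries.coeff_C_mul]
    cases n with
    | zero => simp
    | succ n => simp [PowerSeries.coeff_succ_X_mul, pow_succ, PowerSeries.coeff_one, mul_comm]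
  have h1 : (coeffPoly φ r).eval (μ j)
      = PowerSeries.coeff r (PowerSeries.mk φ * PowerSeries.mk (fun k => μ j ^ k)) := by
    rw [PowerSeries.coeff_mul, Finset.Nat.sum_antidiagonal_eq_sum_range_succ_mk, coeffPoly,
      eval_finsetSum, ← Finset.sum_range_reflect]
    refine Finset.sum_congr rfl fun k hk => ?_
    have := Finset.mem_range.1 hk
    simp only [eval_mul, eval_C, eval_pow, eval_X, PowerSeries.coeff_mk]
    rw [show r - (r + 1 - 1 - k) = k by omega, Nat.add_sub_cancel]
  have h2 : PowerSeries.mk φ * PowerSeries.mk (fun k => μ j ^ k)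
      = PowerSeries.C s * (cSeries E * branchSeries (Finset.univ.erase j) μ) := by
    rw [hφ, branchSeries, ← Finset.mul_prod_erase _ _ (Finset.mem_univ j), ← branchSeries]
    linear_combination cSeries E * PowerSeries.C s * branchSeries (Finset.univ.erase j) μ * hgeom
  rw [h1, h2, PowerSeries.coeff_C_mul, PowerSeries.coeff_mul,
    Finset.Nat.sum_antidiagonal_eq_sum_range_succ_mk]
  congr 1
  simp only [coeff_branchSeries_erase, cSeries, PowerSeries.coeff_mk]
  -- The terms with `p < r - g` vanish because `Φ_k` does for `k ≥ g`.
  symm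
  apply Finset.sum_subset
  · intro p hp
    have := Finset.mem_Icc.1 hp
    exact Finset.mem_range.2 (by omega)
  · intro p hp hp'
    have := Finset.mem_range.1 hp
    rw [Finset.mem_Icc] at hp'
    rw [Phi_eq_zero j μ (by omega), mul_zero]

/-! ### Passing from polynomials in `z` to series in `w = 1 / z` -/

/-- The expansion of `w^N P(1/w)`; meaningful only for `deg P ≤ N`, since `reflect N` leaves the
coefficients beyond `N` in place. -/
def revSeries (N : ℕ) (P : ℂ[X]) : PowerSeries ℂ := (P.reflect N : ℂ[X])

theorem revSeries_add (N : ℕ) (P Q : ℂ[X]) :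
    revSeries N (P + Q) = revSeries N P + revSeries N Q := by
  simp [revSeries, reflect_add]

theorem revSeries_C_mul (N : ℕ) (a : ℂ) (P : ℂ[X]) :
    revSeries N (C a * P) = PowerSeries.C a * revSeries N P := by
  simp [revSeries, reflect_C_mul]

theorem revSeries_sub (N : ℕ) (P Q : ℂ[X]) :
    revSeries N (P - Q) = revSeries N P - revSeries N Q := by
  have : P - Q = P + C (-1) * Q := by simp [sub_eq_add_neg]
  rw [this, revSeries_add, revSeries_C_mul]
  simp [sub_eq_add_neg]

theorem revSeries_mul {M N : ℕ} {P Q : ℂ[X]} (hP : P.natDegree ≤ M) (hQ : Q.natDegree ≤ N) :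
    revSeries (M + N) (P * Q) = revSeries M P * revSeries N Q := by
  simp [revSeries, reflect_mul P Q hP hQ]

theorem revSeries_succ {N : ℕ} {P : ℂ[X]} (hP : P.natDegree ≤ N) :
    revSeries (N + 1) P = PowerSeries.X * revSeries N P := by
  have h := revSeries_mul (P := 1) (M := 1) (by simp) hP
  rw [one_mul, add_comm 1] at h
  rw [h]
  simp [revSeries, reflect_one]

theorem revSeries_X_mul {N : ℕ} {P : ℂ[X]} (hP : P.natDegree ≤ N) :
    revSeries (N + 1) (X * P) = revSeries N P := by
  have h := revSeries_mul (P := X) (M := 1) natDegree_X_le hP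
  rw [add_comm 1] at h
  rw [h]
  simp [revSeries]

theorem revSeries_prod {ι : Type} (s : Finset ι) (μ : ι → ℂ) :
    revSeries s.card (∏ l ∈ s, (X - C (μ l))) = branchSeries s μ := by
  classical
  induction s using Finset.induction_on with
  | empty => simp [revSeries, branchSeries]
  | insert i s hi ih =>
    rw [Finset.prod_insert hi, Finset.card_insert_of_notMem hi, add_comm, revSeries_mul
      (natDegree_X_sub_C_le _) (by rw [natDegree_prod_of_monic _ _ fun l _ => monic_X_sub_C _]; simp),
      ih, branchSeries, branchSeries, Finset.prod_insert hi]
    congr 1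
    rw [revSeries_sub]
    simp [revSeries, reflect_C]

theorem revSeries_prod_univ {n : ℕ} (μ : Fin n → ℂ) :
    revSeries n (∏ l, (X - C (μ l))) = branchSeries Finset.univ μ := by
  have := revSeries_prod Finset.univ μ
  rwa [Finset.card_univ, Fintype.card_fin] at this

theorem coeff_coeffPoly (f : ℕ → ℂ) (n k : ℕ) :
    (coeffPoly f n).coeff k = if k ≤ n then f (n - k) else 0 := by
  simp [coeffPoly, coeff_C_mul, coeff_X_pow]

theorem natDegree_coeffPoly_le (f : ℕ → ℂ) (n : ℕ) : (coeffPoly f n).natDegree ≤ n := by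
  rw [natDegree_le_iff_coeff_eq_zero]
  intro k hk
  rw [coeff_coeffPoly, if_neg (by omega)]

/-- The truncated generating series `∑_{k ≤ n} f_k w^k`. -/
def truncSeries {A : Type} [CommRing A] (n : ℕ) (f : ℕ → A) : PowerSeries A :=
  PowerSeries.mk fun k => if k ≤ n then f k else 0

theorem coeff_truncSeries {A : Type} [CommRing A] (n : ℕ) (f : ℕ → A) (k : ℕ) :
    PowerSeries.coeff k (truncSeries n f) = if k ≤ n then f k else 0 := by
  simp [truncSeries]

theorem map_truncSeries {A B : Type} [CommRing A] [CommRing B] (φ : A →+* B) (n : ℕ)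
    (f : ℕ → A) :
    PowerSeries.map φ (truncSeries n f) = truncSeries n fun k => φ (f k) := by
  ext k
  simp only [PowerSeries.coeff_map, coeff_truncSeries]
  split_ifs <;> simp

theorem revSeries_coeffPoly (f : ℕ → ℂ) (n : ℕ) :
    revSeries n (coeffPoly f n) = truncSeries n f := by
  ext k
  rw [coeff_truncSeries, revSeries, Polynomial.coeff_coe, coeff_reflect, coeff_coeffPoly]
  by_cases hk : k ≤ n
  · rw [revAt_le hk, if_pos (by omega), if_pos hk, Nat.sub_sub_self hk]
  · rw [revAt_eq_self_of_lt (by omega), if_neg hk, if_neg hk]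

theorem constantCoeff_truncSeries {A : Type} [CommRing A] (n : ℕ) (f : ℕ → A) :
    PowerSeries.constantCoeff (truncSeries n f) = f 0 := by
  rw [← PowerSeries.coeff_zero_eq_constantCoeff_apply, coeff_truncSeries, if_pos (Nat.zero_le n)]

/-- In terms of `w = 1 / z`, the zeros `μ_l` of a polynomial factor its truncated generating
series. -/
theorem truncSeries_eq_of_coeffPoly_eq {g : ℕ} {f : ℕ → ℂ} {s : ℂ} {μ : Fin g → ℂ}
    (h : coeffPoly f g = C s * ∏ l, (X - C (μ l))) :
    truncSeries g f = PowerSeries.C s * branchSeries Finset.univ μ := by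
  rw [← revSeries_coeffPoly, h, revSeries_C_mul, revSeries_prod_univ]

/-! ### Constants of the total derivative and of the shift -/

theorem eq_C_of_pderiv_eq_zero {ι : Type} {P : MvPolynomial ι ℂ}
    (h : ∀ i, MvPolynomial.pderiv i P = 0) : P = MvPolynomial.C (MvPolynomial.constantCoeff P) := by
  classical
  ext m
  rw [MvPolynomial.coeff_C]
  split_ifs with hm
  · rw [← hm, MvPolynomial.constantCoeff_eq]
  · obtain ⟨i, hi⟩ : ∃ i, m i ≠ 0 := by
      by_contra! h0
      exact hm (Finsupp.ext fun i => (h0 i).symm)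
    have h1 := congrArg (MvPolynomial.coeff (m - Finsupp.single i 1)) (h i)
    rw [MvPolynomial.coeff_pderiv, tsub_add_cancel_of_le
      (Finsupp.single_le_iff.2 (Nat.one_le_iff_ne_zero.2 hi)), MvPolynomial.coeff_zero] at h1
    exact (mul_eq_zero.1 h1).resolve_right (Nat.cast_add_one_ne_zero _)

theorem pderiv_totalDeriv {ι : Type} {s : ι → ι} (hs : Function.Injective s) (i : ι)
    (P : MvPolynomial ι ℂ) :
    MvPolynomial.pderiv (s i) (totalDeriv s P)
      = totalDeriv s (MvPolynomial.pderiv (s i) P) + MvPolynomial.pderiv i P := by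
  classical
  have h : ⁅(MvPolynomial.pderiv (s i) : Derivation ℂ (MvPolynomial ι ℂ) (MvPolynomial ι ℂ)),
      totalDeriv s⁆ = MvPolynomial.pderiv i := by
    apply MvPolynomial.derivation_ext
    intro k
    rw [Derivation.commutator_apply]
    simp only [totalDeriv, MvPolynomial.mkDerivation_X, MvPolynomial.pderiv_X, Pi.single_apply,
      hs.eq_iff]
    split_ifs <;> simp
  rw [← h, Derivation.commutator_apply]
  ring

/-- Only constants have vanishing total derivative. The commutator of `∂/∂X_{s i}` with the total
derivative is `∂/∂X_i`, so a vanishing partial derivative at one index of an orbit of `s`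
propagates backwards along the orbit. -/
theorem eq_C_of_totalDeriv_eq_zero {ι : Type} {s : ι → ι} (hs : Function.Injective s)
    (horbit : ∀ (S : Finset ι) (i : ι), ∃ n, s^[n] i ∉ S) {P : MvPolynomial ι ℂ}
    (h : totalDeriv s P = 0) : P = MvPolynomial.C (MvPolynomial.constantCoeff P) := by
  apply eq_C_of_pderiv_eq_zero
  intro i
  obtain ⟨n, hn⟩ := horbit P.vars i
  have hn' := MvPolynomial.pderiv_eq_zero_of_notMem_vars hn
  clear hn
  induction n with
  | zero => exact hn'
  | succ n ih =>
    apply ih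
    rw [Function.iterate_succ_apply'] at hn'
    have := pderiv_totalDeriv hs (s^[n] i) P
    rwa [h, hn', map_zero, map_zero, zero_add, eq_comm] at this

theorem DiffPoly.eq_C {P : DiffPoly} (h : DiffPoly.D P = 0) :
    P = MvPolynomial.C (MvPolynomial.constantCoeff P) := by
  refine eq_C_of_totalDeriv_eq_zero Nat.succ_injective (fun S i => ⟨S.sup id + 1, fun hS => ?_⟩) h
  have := Finset.le_sup (f := id) hS
  rw [Nat.succ_iterate] at this
  simp only [id] at this
  omega

theorem DiffPoly₂.eq_C {P : DiffPoly₂} (h : DiffPoly₂.D P = 0) :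
    P = MvPolynomial.C (MvPolynomial.constantCoeff P) := by
  refine eq_C_of_totalDeriv_eq_zero (Nat.succ_injective.sumMap Nat.succ_injective)
    (fun S i => ⟨S.sup (Sum.elim id id) + 1, fun hS => ?_⟩) h
  have hit : ∀ n, (Sum.map Nat.succ Nat.succ)^[n] i = Sum.map (n + ·) (n + ·) i := by
    intro n
    induction n with
    | zero => cases i <;> simp
    | succ n ih => rw [Function.iterate_succ_apply', ih]; cases i <;> simp <;> omega
  have := Finset.le_sup (f := Sum.elim id id) hS
  rw [hit] at this
  cases i <;> simp only [Sum.map_inl, Sum.map_inr, Sum.elim_inl, Sum.elim_inr, id] at this <;>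
    omega

/-- Only constants are shift invariant: the finite set of variables of an invariant polynomial is
mapped into itself by the shift. -/
theorem ShiftPoly.eq_C {P : ShiftPoly} (h : ShiftPoly.S (-1) P = P) :
    P = MvPolynomial.C (MvPolynomial.constantCoeff P) := by
  classical
  have hinv : ∀ i ∈ P.vars, ∃ k ∈ P.vars, Sum.map (· + (-1)) (· + (-1)) k = i := by
    intro i hi
    have hsub := MvPolynomial.vars_rename (Sum.map (· + (-1 : ℤ)) (· + (-1 : ℤ))) P
    rw [show MvPolynomial.rename _ P = P from h] at hsub
    simpa using hsub hi
  have hempty : P.vars = ∅ := by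
    by_contra hne
    obtain ⟨i, hi, hmax⟩ := Finset.exists_max_image P.vars (Sum.elim id id)
      (Finset.nonempty_iff_ne_empty.2 hne)
    obtain ⟨k, hk, rfl⟩ := hinv i hi
    have := hmax k hk
    cases k <;> simp at this
  exact eq_C_of_pderiv_eq_zero fun i =>
    MvPolynomial.pderiv_eq_zero_of_notMem_vars (by simp [hempty])

/-! ### Power series with coefficients in a differential algebra -/

section psD
variable {A : Type} [CommRing A] [Algebra ℂ A] (D : Derivation ℂ A A)

theorem psD_ofNat (n : ℕ) [n.AtLeastTwo] : psD D (ofNat(n) : PowerSeries A) = 0 := by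
  rw [show (OfNat.ofNat n : PowerSeries A) = PowerSeries.C (OfNat.ofNat n) from
    (map_ofNat _ _).symm, psD_C, derivation_ofNat, map_zero]

theorem psD_map_algebraMap (c : PowerSeries ℂ) :
    psD D (PowerSeries.map (algebraMap ℂ A) c) = 0 := by
  ext n
  simp [psD_coeff]

theorem X_pow_dvd_psD {n : ℕ} {F : PowerSeries A} (h : PowerSeries.X ^ n ∣ F) :
    PowerSeries.X ^ n ∣ psD D F := by
  rw [PowerSeries.X_pow_dvd_iff] at h ⊢
  intro m hm
  rw [psD_coeff, h m hm, map_zero]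

theorem psD_map {B : Type} [CommRing B] [Algebra ℂ B] {D : Derivation ℂ A A}
    {D' : Derivation ℂ B B} {φ : A →+* B} (h : ∀ a, D' (φ a) = φ (D a)) (F : PowerSeries A) :
    psD D' (PowerSeries.map φ F) = PowerSeries.map φ (psD D F) := by
  ext n
  simp [psD_coeff, h]

theorem psD_truncSeries (n : ℕ) (f : ℕ → A) :
    psD D (truncSeries n f) = truncSeries n fun k => D (f k) := by
  ext k
  simp only [psD_coeff, coeff_truncSeries]
  split_ifs <;> simp

end psD

theorem isUnit_ofNat {A : Type} [CommRing A] [Algebra ℂ A] (n : ℕ) [n.AtLeastTwo] :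
    IsUnit (OfNat.ofNat n : A) := by
  rw [← map_ofNat (algebraMap ℂ A) n]
  exact (IsUnit.mk0 _ (OfNat.ofNat_ne_zero n)).map _

/-- Series that agree modulo every power of the variable are equal; solutions with the
same first integral are shown to be equal by raising the order of their difference step by step. -/
theorem eq_of_forall_X_pow_dvd {A : Type} [CommRing A] {F G : PowerSeries A}
    (h : ∀ n, PowerSeries.X ^ n ∣ F - G) : F = G := by
  ext n
  have := PowerSeries.X_pow_dvd_iff.1 (h (n + 1)) n n.lt_succ_self
  rwa [map_sub, sub_eq_zero] at this

theorem X_pow_dvd_map {A B : Type} [CommRing A] [CommRing B] (φ : A →+* B) {n : ℕ}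
    {K : PowerSeries A}
    (h : PowerSeries.X ^ n ∣ K) : PowerSeries.X ^ n ∣ PowerSeries.map φ K := by
  have := map_dvd (PowerSeries.map φ) h
  rwa [map_pow, PowerSeries.map_X] at this

theorem constantCoeff_map {A B : Type} [CommRing A] [CommRing B] (φ : A →+* B)
    (F : PowerSeries A) :
    PowerSeries.constantCoeff (PowerSeries.map φ F) = φ (PowerSeries.constantCoeff F) := by
  rw [← PowerSeries.coeff_zero_eq_constantCoeff_apply, PowerSeries.coeff_map,
    PowerSeries.coeff_zero_eq_constantCoeff_apply]

/-- A jet evaluation intertwines the total derivative with a derivation. -/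
theorem derivation_aeval {ι A : Type} [CommRing A] [Algebra ℂ A] (D : Derivation ℂ A A)
    {s : ι → ι} {v : ι → A} (hv : ∀ i, D (v i) = v (s i)) (P : MvPolynomial ι ℂ) :
    D (MvPolynomial.aeval v P) = MvPolynomial.aeval v (totalDeriv s P) := by
  induction P using MvPolynomial.induction_on with
  | C a => simp [totalDeriv]
  | add p q hp hq => simp [hp, hq]
  | mul_X p i hp =>
    simp only [map_mul, Derivation.leibniz, smul_eq_mul, map_add, hp, MvPolynomial.aeval_X, hv]
    simp [totalDeriv]

/-! ### The differential algebra of smooth functions -/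

/-- The algebra of smooth functions `ℝ → ℂ`. -/
def SmoothFun : Subalgebra ℂ (ℝ → ℂ) where
  carrier := {f | ContDiff ℝ ∞ f}
  mul_mem' {f g} (hf : ContDiff ℝ ∞ f) (hg : ContDiff ℝ ∞ g) :=
    show ContDiff ℝ ∞ (f * g) from hf.mul hg
  add_mem' {f g} (hf : ContDiff ℝ ∞ f) (hg : ContDiff ℝ ∞ g) :=
    show ContDiff ℝ ∞ (f + g) from hf.add hg
  algebraMap_mem' c := show ContDiff ℝ ∞ (fun _ => c) from contDiff_const

namespace SmoothFun

theorem differentiable (f : SmoothFun) : Differentiable ℝ (f : ℝ → ℂ) :=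
  (contDiff_infty_iff_deriv.1 f.2).1

/-- `d/dx` on smooth functions. -/
def D : Derivation ℂ SmoothFun SmoothFun where
  toFun f := ⟨deriv f, (contDiff_infty_iff_deriv.1 f.2).2⟩
  map_add' f g := Subtype.ext <| funext fun x => deriv_add (differentiable f x) (differentiable g x)
  map_smul' c f := Subtype.ext <| funext fun x => deriv_const_smul c (differentiable f x)
  map_one_eq_zero' := Subtype.ext <| funext fun x => deriv_const x (1 : ℂ)
  leibniz' f g := Subtype.ext <| funext fun x => by
    have := deriv_mul (differentiable f x) (differentiable g x)
    simp only [LinearMap.coe_mk, AddHom.coe_mk, smul_eq_mul]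
    change deriv ((f : ℝ → ℂ) * (g : ℝ → ℂ)) x
      = (f : ℝ → ℂ) x * deriv g x + (g : ℝ → ℂ) x * deriv f x
    rw [this]
    ring

/-- Evaluation at `x`. -/
def ev (x : ℝ) : SmoothFun →ₐ[ℂ] ℂ := (Pi.evalAlgHom ℂ (fun _ => ℂ) x).comp SmoothFun.val

theorem ev_apply (x : ℝ) (f : SmoothFun) : ev x f = (f : ℝ → ℂ) x := rfl

theorem ev_mk (x : ℝ) (f : ℝ → ℂ) (hf : ContDiff ℝ ∞ f) : ev x (⟨f, hf⟩ : SmoothFun) = f x := rfl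

theorem ev_D (x : ℝ) (f : SmoothFun) : ev x (D f) = deriv f x := rfl

theorem ev_iterate_D (x : ℝ) (n : ℕ) (f : SmoothFun) : ev x (D^[n] f) = iteratedDeriv n f x := by
  rw [iteratedDeriv_eq_iterate]
  induction n generalizing f with
  | zero => rfl
  | succ n ih =>
    rw [Function.iterate_succ_apply, Function.iterate_succ_apply, ih]
    rfl

theorem ext_ev {f g : SmoothFun} (h : ∀ x, ev x f = ev x g) : f = g :=
  Subtype.ext <| funext h

theorem ext_map_ev {F G : PowerSeries SmoothFun}
    (h : ∀ x, PowerSeries.map (ev x : SmoothFun →+* ℂ) F = PowerSeries.map (ev x) G) : F = G := by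
  ext1 n
  apply ext_ev
  intro x
  have := congrArg (PowerSeries.coeff n) (h x)
  rwa [PowerSeries.coeff_map, PowerSeries.coeff_map] at this

theorem map_ev_algebraMap (x : ℝ) (c : PowerSeries ℂ) :
    PowerSeries.map (ev x : SmoothFun →+* ℂ) (PowerSeries.map (algebraMap ℂ SmoothFun) c) = c := by
  ext n
  rw [PowerSeries.coeff_map, PowerSeries.coeff_map]
  rfl

/-- A series whose coefficients have derivative zero equals its value at any point. -/
theorem eq_map_algebraMap {Q : PowerSeries SmoothFun} (h : psD D Q = 0) {q : PowerSeries ℂ}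
    {x₀ : ℝ} (hq : PowerSeries.map (ev x₀ : SmoothFun →+* ℂ) Q = q) :
    Q = PowerSeries.map (algebraMap ℂ SmoothFun) q := by
  apply ext_map_ev
  intro x
  rw [map_ev_algebraMap, ← hq]
  ext n
  rw [PowerSeries.coeff_map, PowerSeries.coeff_map]
  refine is_const_of_deriv_eq_zero (differentiable (PowerSeries.coeff n Q)) (fun y => ?_) x x₀
  have := congrArg (PowerSeries.coeff n) h
  rw [psD_coeff, map_zero] at this
  rw [← ev_D, this, map_zero]

end SmoothFun

/-! ### KdV -/

section kdvForm
variable {A : Type} [CommRing A] [Algebra ℂ A] (D : Derivation ℂ A A) (V : A)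

/-- The quadratic form `4 F² + w (2 F F_xx - F_x² - 4 V F²)`, which is `4 w^{2g+1} R_{2g+1}(1/w)`
for the reversed polynomial `F = w^g F_g(1/w)`. -/
def kdvForm (F : PowerSeries A) : PowerSeries A :=
  4 * (F * F) + PowerSeries.X * (2 * (F * psD D (psD D F)) - psD D F * psD D F
    - 4 * (PowerSeries.C V * (F * F)))

/-- The derivative of the form is `2 F` times the linear KdV recursion. -/
theorem psD_kdvForm {F : PowerSeries A}
    (h : 4 * psD D F = PowerSeries.X * (-psD D (psD D (psD D F))
      + 4 * (PowerSeries.C V * psD D F) + 2 * (PowerSeries.C (D V) * F))) :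
    psD D (kdvForm D V F) = 0 := by
  simp only [kdvForm, psD_add, psD_sub, psD_mul, psD_X, psD_C, psD_ofNat]
  linear_combination 2 * F * h

theorem kdvForm_mul {c : PowerSeries A} (hc : psD D c = 0) (F : PowerSeries A) :
    kdvForm D V (c * F) = c ^ 2 * kdvForm D V F := by
  simp only [kdvForm, psD_mul, hc, zero_mul, add_zero]
  ring

theorem map_kdvForm {B : Type} [CommRing B] [Algebra ℂ B] {D : Derivation ℂ A A}
    {D' : Derivation ℂ B B} {φ : A →+* B} (h : ∀ a, D' (φ a) = φ (D a)) (F : PowerSeries A) :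
    PowerSeries.map φ (kdvForm D V F) = kdvForm D' (φ V) (PowerSeries.map φ F) := by
  simp only [kdvForm, psD_map h, map_add, map_sub, map_mul, PowerSeries.map_X, PowerSeries.map_C,
    map_ofNat]

/-- The quadratic form determines a series with constant coefficient `1`. -/
theorem kdvForm_injective {F G : PowerSeries A} (hF : PowerSeries.constantCoeff F = 1)
    (hG : PowerSeries.constantCoeff G = 1) (h : kdvForm D V F = kdvForm D V G) : F = G := by
  apply eq_of_forall_X_pow_dvd
  intro n
  induction n with
  | zero => simp
  | succ n ih =>
    -- Subtracting the two equations gives `4 (F + G) (F - G) = w · (terms divisible by w^n)`.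
    have hu : IsUnit (4 * (F + G)) := by
      rw [PowerSeries.isUnit_iff_constantCoeff]
      simp only [map_mul, map_add, hF, hG, map_ofNat]
      norm_num
      exact isUnit_ofNat 8
    have e : 4 * (F + G) * (F - G) = PowerSeries.X * -(2 * F * psD D (psD D (F - G))
        + 2 * (F - G) * psD D (psD D G) - psD D (F - G) * (psD D F + psD D G)
        - 4 * PowerSeries.C V * (F + G) * (F - G)) := by
      simp only [kdvForm] at h
      simp only [psD_sub]
      linear_combination h
    have h1 := X_pow_dvd_psD D ih
    have h2 := X_pow_dvd_psD D h1
    rw [← hu.dvd_mul_left, e, pow_succ']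
    refine mul_dvd_mul_left _ (dvd_neg.2 (dvd_sub (dvd_sub (dvd_add ?_ ?_) ?_) ?_))
    · exact h2.mul_left _
    · exact (ih.mul_left _).mul_right _
    · exact h1.mul_right _
    · exact ih.mul_left _

end kdvForm

/-- In the ring of differential polynomials the form of the homogeneous series is a constant, which
can be read off after setting all jet variables to zero. -/
theorem kdvForm_kdvHat :
    kdvForm DiffPoly.D (MvPolynomial.X 0) (PowerSeries.mk kdvHat) = 4 := by
  have hs := kdvHat_spec
  have e1 : (4 : DiffPoly) * MvPolynomial.C (-(1 / 4)) = -1 := by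
    rw [← map_ofNat MvPolynomial.C 4, ← MvPolynomial.C_mul]; norm_num
  have e2 : (4 : DiffPoly) * MvPolynomial.C (1 / 2) = 2 := by
    rw [← map_ofNat MvPolynomial.C 4, ← MvPolynomial.C_mul, ← map_ofNat MvPolynomial.C 2]; norm_num
  have hX : DiffPoly.D (MvPolynomial.X 0) = MvPolynomial.X 1 := by simp [totalDeriv]
  have hD : psD DiffPoly.D (kdvForm DiffPoly.D (MvPolynomial.X 0) (PowerSeries.mk kdvHat)) = 0 := by
    apply psD_kdvForm
    rw [← map_ofNat PowerSeries.C 4, ← map_ofNat PowerSeries.C 2]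
    ext1 n
    cases n with
    | zero => simp [psD_coeff, hs.zero]
    | succ n =>
      rw [PowerSeries.coeff_succ_X_mul]
      simp only [map_add, map_neg, PowerSeries.coeff_C_mul, psD_coeff, PowerSeries.coeff_mk,
        hs.succ n, hX]
      simp only [map_neg] at e1 ⊢
      linear_combination DiffPoly.D (DiffPoly.D (DiffPoly.D (kdvHat n))) * e1
        + MvPolynomial.X 1 * kdvHat n * e2
  have hc : PowerSeries.map MvPolynomial.constantCoeff (PowerSeries.mk kdvHat) = 1 := by
    ext n
    cases n with
    | zero => simp [hs.zero]
    | succ n => simp [hs.const n, PowerSeries.coeff_one]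
  have h4 : PowerSeries.map MvPolynomial.constantCoeff
      (kdvForm DiffPoly.D (MvPolynomial.X 0) (PowerSeries.mk kdvHat)) = 4 := by
    rw [map_kdvForm (D' := 0) (φ := MvPolynomial.constantCoeff) _
      (fun a => (constantCoeff_totalDeriv _ a).symm), hc]
    have h0 : psD (0 : Derivation ℂ ℂ ℂ) 0 = 0 := by ext; simp [psD_coeff]
    simp [kdvForm, psD_one, h0]
  rw [← map_ofNat PowerSeries.C 4] at h4 ⊢
  ext1 n
  have hn := congrArg (PowerSeries.coeff n) hD
  rw [psD_coeff, map_zero] at hn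
  have h4n := congrArg (PowerSeries.coeff n) h4
  rw [PowerSeries.coeff_map, PowerSeries.coeff_C] at h4n
  rw [DiffPoly.eq_C hn, h4n, PowerSeries.coeff_C]
  split_ifs
  · exact map_ofNat _ _
  · exact map_zero _

/-- The homogeneous coefficients are `∏ (1 - E_m w)^{-1/2}` times any normalized solution of the
quadratic equation with right-hand side `4 ∏ (1 - E_m w)`. -/
theorem kdvHat_series {M : ℕ} (V : SmoothFun) (E : Fin M → ℂ) (F : PowerSeries SmoothFun)
    (hF : PowerSeries.constantCoeff F = 1)
    (hQ : kdvForm SmoothFun.D V F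
      = PowerSeries.map (algebraMap ℂ SmoothFun) (4 * branchSeries Finset.univ E)) (x : ℝ) :
    PowerSeries.mk (fun k => evalJet V x (kdvHat k))
      = cSeries E * PowerSeries.map (SmoothFun.ev x) F := by
  let φ : DiffPoly →ₐ[ℂ] SmoothFun := MvPolynomial.aeval fun k => SmoothFun.D^[k] V
  have hφ : ∀ P, SmoothFun.D (φ P) = φ (DiffPoly.D P) :=
    derivation_aeval SmoothFun.D fun k => (Function.iterate_succ_apply' _ _ _).symm
  have hev : ∀ P, evalJet V x P = SmoothFun.ev x (φ P) := by
    intro P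
    simp only [φ, evalJet, ← AlgHom.comp_apply, MvPolynomial.comp_aeval, SmoothFun.ev_iterate_D]
  have h1 := congrArg (PowerSeries.map (φ : DiffPoly →+* SmoothFun)) kdvForm_kdvHat
  rw [map_kdvForm (D' := SmoothFun.D) (φ := (φ : DiffPoly →+* SmoothFun)) _ hφ, map_ofNat] at h1
  have hV : (φ : DiffPoly →+* SmoothFun) (MvPolynomial.X 0) = V := by simp [φ]
  rw [hV] at h1
  have key : PowerSeries.map (φ : DiffPoly →+* SmoothFun) (PowerSeries.mk kdvHat)
      = PowerSeries.map (algebraMap ℂ SmoothFun) (cSeries E) * F := by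
    apply kdvForm_injective SmoothFun.D V
    · rw [constantCoeff_map, PowerSeries.constantCoeff_mk, kdvHat_spec.zero, map_one]
    · rw [map_mul, hF, constantCoeff_map, constantCoeff_cSeries, map_one, one_mul]
    · rw [h1, kdvForm_mul _ _ (psD_map_algebraMap _ _), hQ, ← map_pow, ← map_mul,
        mul_left_comm, cSeries_sq, mul_one, map_ofNat]
  have h2 := congrArg (PowerSeries.map (SmoothFun.ev x : SmoothFun →+* ℂ)) key
  rw [map_mul, SmoothFun.map_ev_algebraMap] at h2
  rw [← h2]
  ext k
  simp [hev]

/-- The form of the reversed polynomial is `4 w^{2g+1} R_{2g+1}(1/w)`. -/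
theorem revSeries_kdvR (g : ℕ) (V : SmoothFun) (f : ℕ → SmoothFun) (x : ℝ) :
    PowerSeries.map (SmoothFun.ev x : SmoothFun →+* ℂ)
        (kdvForm SmoothFun.D V (truncSeries g f))
      = 4 * revSeries (2 * g + 1) (kdvR g V (fun k => f k) x) := by
  obtain ⟨P, hP⟩ : ∃ P, P = coeffPoly (fun k => (f k : ℝ → ℂ) x) g := ⟨_, rfl⟩
  obtain ⟨P1, hP1⟩ : ∃ P, P = coeffPoly (fun k => deriv (f k) x) g := ⟨_, rfl⟩
  obtain ⟨P2, hP2⟩ : ∃ P, P = coeffPoly (fun k => iteratedDeriv 2 (f k) x) g := ⟨_, rfl⟩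
  have d : P.natDegree ≤ g := hP ▸ natDegree_coeffPoly_le _ _
  have d1 : P1.natDegree ≤ g := hP1 ▸ natDegree_coeffPoly_le _ _
  have d2 : P2.natDegree ≤ g := hP2 ▸ natDegree_coeffPoly_le _ _
  have e0 : PowerSeries.map (SmoothFun.ev x : SmoothFun →+* ℂ) (truncSeries g f)
      = revSeries g P := by
    rw [map_truncSeries, hP, revSeries_coeffPoly]; rfl
  have e1 : PowerSeries.map (SmoothFun.ev x : SmoothFun →+* ℂ) (psD SmoothFun.D (truncSeries g f))
      = revSeries g P1 := by
    rw [psD_truncSeries, map_truncSeries, hP1, revSeries_coeffPoly]; rfl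
  have e2 : PowerSeries.map (SmoothFun.ev x : SmoothFun →+* ℂ)
      (psD SmoothFun.D (psD SmoothFun.D (truncSeries g f))) = revSeries g P2 := by
    rw [psD_truncSeries, psD_truncSeries, map_truncSeries, hP2, revSeries_coeffPoly]
    congr 1
    ext k
    exact SmoothFun.ev_iterate_D x 2 (f k)
  have hR : kdvR g V (fun k => f k) x = C (1 / 2) * (P2 * P) - C (1 / 4) * (P1 * P1)
      - (C ((V : ℝ → ℂ) x) * (P * P) - X * (P * P)) := by
    rw [kdvR, kdvF, ← hP, ← hP1, ← hP2]
    ring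
  have dm : ∀ {A B : ℂ[X]}, A.natDegree ≤ g → B.natDegree ≤ g → (A * B).natDegree ≤ g + g :=
    fun hA hB => natDegree_mul_le_of_le hA hB
  rw [hR, two_mul, revSeries_sub, revSeries_sub, revSeries_sub, revSeries_C_mul, revSeries_C_mul,
    revSeries_C_mul, revSeries_X_mul (dm d d), revSeries_succ (dm d d), revSeries_succ (dm d1 d1),
    revSeries_succ (dm d2 d), revSeries_mul d d, revSeries_mul d1 d1, revSeries_mul d2 d]
  simp only [kdvForm, map_add, map_sub, map_mul, map_ofNat, PowerSeries.map_X, PowerSeries.map_C,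
    e0, e1, e2]
  have c1 : (4 : PowerSeries ℂ) * PowerSeries.C (1 / 2) = 2 := by
    rw [← map_ofNat PowerSeries.C 4, ← map_mul, ← map_ofNat PowerSeries.C 2]; norm_num
  have c2 : (4 : PowerSeries ℂ) * PowerSeries.C (1 / 4) = 1 := by
    rw [← map_ofNat PowerSeries.C 4, ← map_mul, ← map_one PowerSeries.C]; norm_num
  have c3 : (SmoothFun.ev x : SmoothFun →+* ℂ) V = (V : ℝ → ℂ) x := rfl
  rw [c3]
  linear_combination -PowerSeries.X * revSeries g P2 * revSeries g P * c1
    + PowerSeries.X * revSeries g P1 * revSeries g P1 * c2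

theorem kdv_eval {g : ℕ} (r : ℕ) (j : Fin g) (V : ℝ → ℂ) (f : ℕ → ℝ → ℂ)
    (E : Fin (2 * g + 1) → ℂ) (x₀ : ℝ) (hst : IsStationaryKdV g V f)
    (hR : kdvR g V f x₀ = ∏ m, (X - C (E m))) (x : ℝ) (μ : Fin g → ℂ)
    (hF : kdvF g f x = ∏ l, (X - C (μ l))) :
    (kdvFHat V r x).eval (μ j) = ∑ p ∈ Finset.Icc (r - g) r, cCoeff p E * Phi (r - p) j μ := by
  let W : SmoothFun := ⟨V, hst.smooth_V⟩
  let φ : ℕ → SmoothFun := fun k => ⟨f k, hst.smooth k⟩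
  have hrec : ∀ k, 4 * SmoothFun.D (φ (k + 1)) = -SmoothFun.D (SmoothFun.D (SmoothFun.D (φ k)))
      + 4 * (W * SmoothFun.D (φ k)) + 2 * (SmoothFun.D W * φ k) := by
    intro k
    apply SmoothFun.ext_ev
    intro y
    have h3 : SmoothFun.ev y (SmoothFun.D (SmoothFun.D (SmoothFun.D (φ k))))
        = iteratedDeriv 3 (f k) y := SmoothFun.ev_iterate_D y 3 (φ k)
    simp only [map_add, map_mul, map_neg, map_ofNat, h3]
    simp only [SmoothFun.ev_D]
    simp only [W, φ, SmoothFun.ev_mk, hst.succ k y]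
    ring
  have h0 : φ 0 = 1 := SmoothFun.ext_ev fun y => by simp [φ, SmoothFun.ev_mk, hst.zero y]
  have hlast : SmoothFun.D (φ (g + 1)) = 0 := SmoothFun.ext_ev fun y => by
    simp only [SmoothFun.ev_D, map_zero]; exact hst.stationary y
  have hD : psD SmoothFun.D (kdvForm SmoothFun.D W (truncSeries g φ)) = 0 := by
    apply psD_kdvForm
    simp only [psD_truncSeries]
    rw [← map_ofNat PowerSeries.C 4, ← map_ofNat PowerSeries.C 2]
    ext1 n
    cases n with
    | zero => simp [coeff_truncSeries, h0]
    | succ n =>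
      rw [PowerSeries.coeff_succ_X_mul]
      simp only [map_add, map_neg, PowerSeries.coeff_C_mul, coeff_truncSeries]
      rcases lt_trichotomy n g with h | h | h
      · rw [if_pos (by omega), if_pos h.le, if_pos h.le, if_pos h.le, hrec]
      -- At the truncation index the recursion is the stationary equation `f_{g+1,x} = 0`.
      · subst h
        have := hrec n
        rw [hlast, mul_zero] at this
        simpa using this
      · rw [if_neg (by omega), if_neg (by omega), if_neg (by omega), if_neg (by omega)]
        ring
  have hQ := SmoothFun.eq_map_algebraMap hD (revSeries_kdvR g W φ x₀)
  rw [show kdvR g W (fun k => φ k) x₀ = kdvR g V f x₀ from rfl, hR, revSeries_prod_univ] at hQ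
  have hser := kdvHat_series W E _ (by rw [constantCoeff_truncSeries, h0]) hQ x
  rw [map_truncSeries] at hser
  have ht : truncSeries g (fun k => f k x) = PowerSeries.C 1 * branchSeries Finset.univ μ :=
    truncSeries_eq_of_coeffPoly_eq (by rw [map_one, one_mul]; exact hF)
  have := eval_coeffPoly r j E μ 1 _ (hser.trans (congrArg _ ht))
  rw [one_mul] at this
  exact this

/-! ### The combined sine-Gordon and mKdV hierarchy -/

section sgForm
variable {A : Type} [CommRing A] [Algebra ℂ A] (D : Derivation ℂ A A) {i U : A}
  {F G H : PowerSeries A}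

/-- The zero curvature equations make `w G² + F H` a first integral; here `G` stands for
`w^{g-1} G_{g-1}(1/w)`. -/
theorem psD_sgForm
    (hF : psD D F = -(PowerSeries.C (i * U) * F) - 2 * PowerSeries.C i * G)
    (hH : psD D H = PowerSeries.C (i * U) * H + 2 * PowerSeries.C i * G)
    (hG : PowerSeries.X * psD D G = PowerSeries.C i * (H - F)) :
    psD D (PowerSeries.X * (G * G) + F * H) = 0 := by
  simp only [psD_add, psD_mul, psD_X, hF, hH]
  linear_combination 2 * G * hG

/-- Eliminating `G` and `H` from the zero curvature equations shows that `F` solves the quadratic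
KdV equation with potential `-¼ (u_x² + 2 i u_xx)`, where `U = u_x`. -/
theorem kdvForm_eq_sgForm (hi : i * i = -1) (hDi : D i = 0) {V : A}
    (hV : 4 * V = -(U ^ 2 + 2 * i * D U))
    (hF : psD D F = -(PowerSeries.C (i * U) * F) - 2 * PowerSeries.C i * G)
    (hG : PowerSeries.X * psD D G = PowerSeries.C i * (H - F)) :
    kdvForm D V F = 4 * (PowerSeries.X * (G * G) + F * H) := by
  have hi' : PowerSeries.C i * PowerSeries.C i = -1 := by
    rw [← map_mul, hi, map_neg, map_one]
  have hV' : 4 * PowerSeries.C V = -(PowerSeries.C U ^ 2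
      + 2 * PowerSeries.C i * PowerSeries.C (D U)) := by
    rw [← map_ofNat PowerSeries.C 4, ← map_mul, hV]
    simp [map_ofNat]
  rw [map_mul] at hF
  have hFF : psD D (psD D F) = -(PowerSeries.C i * PowerSeries.C U * psD D F
      + PowerSeries.C i * PowerSeries.C (D U) * F) - 2 * PowerSeries.C i * psD D G := by
    conv_lhs => rw [hF]
    rw [sub_eq_add_neg, ← zero_sub, ← zero_sub (2 * _ * _)]
    simp only [psD_add, psD_sub, psD_mul, psD_C, psD_ofNat, hDi, map_zero]
    have h0 : psD D (0 : PowerSeries A) = 0 := by ext; simp [psD_coeff]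
    rw [h0]
    ring
  rw [kdvForm, hFF]
  linear_combination -PowerSeries.X * F * F * hV' - 4 * F * PowerSeries.C i * hG
    - 4 * F * (H - F) * hi'
    - PowerSeries.X * (psD D F + PowerSeries.C i * PowerSeries.C U * F
      - 2 * PowerSeries.C i * G) * hF
    + PowerSeries.X * (PowerSeries.C U ^ 2 * F * F - 4 * G * G) * hi'

/-- The zero curvature equations are invariant under `F ↔ H`, `u ↦ -u`, `G ↦ -G`. -/
theorem sg_flip
    (hF : psD D F = -(PowerSeries.C (i * U) * F) - 2 * PowerSeries.C i * G)
    (hH : psD D H = PowerSeries.C (i * U) * H + 2 * PowerSeries.C i * G)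
    (hG : PowerSeries.X * psD D G = PowerSeries.C i * (H - F)) :
    psD D H = -(PowerSeries.C (i * -U) * H) - 2 * PowerSeries.C i * -G ∧
    psD D F = PowerSeries.C (i * -U) * F + 2 * PowerSeries.C i * -G ∧
    PowerSeries.X * psD D (-G) = PowerSeries.C i * (F - H) ∧
    PowerSeries.X * (-G * -G) + H * F = PowerSeries.X * (G * G) + F * H := by
  have hneg : psD D (-G) = -psD D G := by
    ext1 n; simp [psD_coeff]
  have hC : PowerSeries.C (i * -U) = -PowerSeries.C (i * U) := by rw [mul_neg, map_neg]
  refine ⟨?_, ?_, ?_, by ring⟩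
  · rw [hC, hH]; ring
  · rw [hC, hF]; ring
  · rw [hneg]; linear_combination -hG

end sgForm

/-- The homogeneous coefficients for the potential `-¼ (U² + 2 i U_x)` in terms of the upper right
entry `F` of the zero curvature matrix; `sg_flip` turns it into the statement about `H`. -/
theorem sg_series {M : ℕ} {U V : SmoothFun} {F G H : PowerSeries SmoothFun}
    {i : SmoothFun} (hi : i = algebraMap ℂ SmoothFun I)
    (hV : 4 * V = -(U ^ 2 + 2 * i * SmoothFun.D U))
    (hF : psD SmoothFun.D F = -(PowerSeries.C (i * U) * F) - 2 * PowerSeries.C i * G)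
    (hH : psD SmoothFun.D H = PowerSeries.C (i * U) * H + 2 * PowerSeries.C i * G)
    (hG : PowerSeries.X * psD SmoothFun.D G = PowerSeries.C i * (H - F))
    (hF0 : PowerSeries.constantCoeff F = 1) {E : Fin M → ℂ} {x₀ : ℝ}
    (hR : PowerSeries.map (SmoothFun.ev x₀ : SmoothFun →+* ℂ) (PowerSeries.X * (G * G) + F * H)
      = branchSeries Finset.univ E) (x : ℝ) :
    PowerSeries.mk (fun k => evalJet V x (kdvHat k))
      = cSeries E * PowerSeries.map (SmoothFun.ev x) F := by
  have hii : i * i = -1 := by rw [hi, ← map_mul, I_mul_I, map_neg, map_one]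
  have hDi : SmoothFun.D i = 0 := by rw [hi, Derivation.map_algebraMap]
  apply kdvHat_series V E F hF0
  rw [kdvForm_eq_sgForm SmoothFun.D hii hDi hV hF hG,
    SmoothFun.eq_map_algebraMap (psD_sgForm SmoothFun.D hF hH hG) hR, map_mul, map_ofNat]

theorem coeffPoly_succ (φ : ℕ → ℂ) (n : ℕ) :
    coeffPoly φ (n + 1) = C (φ (n + 1)) + X * coeffPoly φ n := by
  rw [coeffPoly, Finset.sum_range_succ', coeffPoly, Finset.mul_sum, add_comm]
  congr 1
  · simp
  · refine Finset.sum_congr rfl fun l _ => ?_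
    rw [Nat.add_sub_add_right, pow_succ]
    ring

/-- Evaluation at `μ_j` when the last coefficient is replaced by a multiple of `e`, where
`f_g = α e`. That coefficient is `α'/α` times the product of all `-μ_l`, so dividing by `μ_j` turns it
into `-(α'/α) Φ_{g-1}`; the other coefficients contribute `μ_j` times a polynomial of degree
`r - 1`. -/
theorem sg_eval_of_series {g M : ℕ} (r : ℕ) (j : Fin g) (E : Fin M → ℂ) (μ : Fin g → ℂ)
    (φ f : ℕ → ℂ) {α e : ℂ} (hα : α ≠ 0) (he : e ≠ 0) (hfg : f g = α * e) (α' : ℂ)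
    (hf : coeffPoly f g = ∏ l, (X - C (μ l)))
    (hφ : PowerSeries.mk φ = cSeries E * truncSeries g f) :
    μ j ≠ 0 ∧ (coeffPoly (fun k => if k = r then α' * e else φ k) r).eval (μ j) / μ j
      = ∑ p ∈ Finset.Ico (r - 1 - g) r, cCoeff p E * Phi (r - 1 - p) j μ
        - α' / α * Phi (g - 1) j μ := by
  have hprod : α * e = -((-1) ^ (g - 1) * (μ j * ∏ l ∈ Finset.univ.erase j, μ l)) := by
    have h := congrArg (Polynomial.eval 0) hf
    rw [← coeff_zero_eq_eval_zero, coeff_coeffPoly, if_pos (Nat.zero_le _), Nat.sub_zero, hfg,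
      eval_prod] at h
    rw [h, Finset.mul_prod_erase _ _ (Finset.mem_univ j)]
    simp only [eval_sub, eval_X, eval_C, zero_sub, Finset.prod_neg, Finset.card_univ,
      Fintype.card_fin]
    obtain ⟨k, rfl⟩ : ∃ k, g = k + 1 := ⟨g - 1, by have := j.pos; omega⟩
    rw [Nat.add_sub_cancel, pow_succ]
    ring
  have hμ : μ j ≠ 0 := by
    intro h
    rw [h] at hprod
    simp [hα, he] at hprod
  refine ⟨hμ, ?_⟩
  have hlast : α' * e / μ j = -(α' / α * Phi (g - 1) j μ) := by
    rw [Phi_pred, div_eq_iff hμ]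
    field_simp
    linear_combination α' * hprod
  cases r with
  | zero => simpa [coeffPoly] using hlast
  | succ r =>
    have hsplit : coeffPoly (fun k => if k = r + 1 then α' * e else φ k) (r + 1)
        = C (α' * e) + X * coeffPoly φ r := by
      rw [coeffPoly_succ, if_pos rfl]
      congr 2
      refine Finset.sum_congr rfl fun l _ => ?_
      simp only [if_neg (show ¬ r - l = r + 1 by omega)]
    have ht : truncSeries g f = PowerSeries.C 1 * branchSeries Finset.univ μ :=
      truncSeries_eq_of_coeffPoly_eq (by rw [map_one, one_mul]; exact hf)
    have hv := eval_coeffPoly r j E μ 1 φ (hφ.trans (congrArg _ ht))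
    rw [one_mul] at hv
    rw [hsplit, eval_add, eval_mul, eval_X, eval_C, add_div, mul_div_cancel_left₀ _ hμ, hlast, hv,
      Nat.add_sub_cancel, ← Finset.Ico_add_one_right_eq_Icc]
    ring

theorem hasDerivAt_eval_coeffPoly (φ : ℕ → SmoothFun) (n : ℕ) (z : ℂ) (x : ℝ) :
    HasDerivAt (fun y => (coeffPoly (fun k => SmoothFun.ev y (φ k)) n).eval z)
      ((coeffPoly (fun k => SmoothFun.ev x (SmoothFun.D (φ k))) n).eval z) x := by
  simp only [coeffPoly, eval_finsetSum, eval_mul, eval_C, eval_pow, eval_X]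
  refine HasDerivAt.fun_sum fun l _ => HasDerivAt.mul_const ?_ _
  exact (SmoothFun.differentiable (φ (n - l)) x).hasDerivAt

theorem eq_of_eval_eq_of_ne_zero {P Q : ℂ[X]} (h : ∀ z : ℂ, z ≠ 0 → P.eval z = Q.eval z) :
    P = Q :=
  Polynomial.eq_of_infinite_eval_eq P Q
    ((Set.finite_singleton (0 : ℂ)).infinite_compl.mono fun z hz => h z hz)

/-- Multiplying `G_{g-1}` by `z` makes it a `coeffPoly` of the same formal degree as `F_g` and
`H_g`. -/
theorem X_mul_sgG (g : ℕ) (γ : ℕ → ℝ → ℂ) (x : ℝ) :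
    X * sgG g γ x = coeffPoly (fun k => if k < g then γ k x else 0) g := by
  rw [sgG, coeffPoly, Finset.sum_range_succ', Finset.mul_sum]
  simp only [Nat.sub_zero, lt_irrefl, if_false, map_zero, zero_mul, add_zero]
  refine Finset.sum_congr rfl fun l hl => ?_
  have := Finset.mem_range.1 hl
  rw [if_pos (by omega), pow_succ, show g - 1 - l = g - (l + 1) by omega]
  ring

/-- The entries of the zero curvature equation, as identities of polynomials in `z`; `Q` is
`z G_{g-1}`. -/
theorem sg_zeroCurvature {g : ℕ} {u : ℝ → ℂ} {α β : ℂ} {f h γ : ℕ → ℝ → ℂ}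
    (hst : IsStationarySG g u α β f h γ) {φ η χ : ℕ → SmoothFun}
    (hφ : ∀ k x, SmoothFun.ev x (φ k) = f k x) (hη : ∀ k x, SmoothFun.ev x (η k) = h k x)
    (hχ : ∀ k x, SmoothFun.ev x (χ k) = if k < g then γ k x else 0) (x : ℝ)
    {P Q S P' Q' S' : ℂ[X]}
    (hP : P = coeffPoly (fun k => SmoothFun.ev x (φ k)) g)
    (hQ : Q = coeffPoly (fun k => SmoothFun.ev x (χ k)) g)
    (hS : S = coeffPoly (fun k => SmoothFun.ev x (η k)) g)
    (hP' : P' = coeffPoly (fun k => SmoothFun.ev x (SmoothFun.D (φ k))) g)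
    (hQ' : Q' = coeffPoly (fun k => SmoothFun.ev x (SmoothFun.D (χ k))) g)
    (hS' : S' = coeffPoly (fun k => SmoothFun.ev x (SmoothFun.D (η k))) g) :
    P' = C (-(I * deriv u x)) * P + C (-2 * I) * Q ∧
    S' = C (I * deriv u x) * S + C (2 * I) * Q ∧
    Q' = C I * (X * S - X * P) := by
  have hmat : ∀ z : ℂ, z ≠ 0 → ∀ y : ℝ, sgMatV g f h γ z y =
      !![-(z⁻¹ * (coeffPoly (fun k => SmoothFun.ev y (χ k)) g).eval z),
        z⁻¹ * (coeffPoly (fun k => SmoothFun.ev y (φ k)) g).eval z;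
        (coeffPoly (fun k => SmoothFun.ev y (η k)) g).eval z,
        z⁻¹ * (coeffPoly (fun k => SmoothFun.ev y (χ k)) g).eval z] := by
    intro z hz y
    simp only [hφ, hη, hχ, ← X_mul_sgG, eval_mul, eval_X, inv_mul_cancel_left₀ hz, sgMatV, sgF,
      one_div]
  have entries : ∀ z : ℂ, z ≠ 0 →
      P'.eval z = -(I * deriv u x) * P.eval z - 2 * I * Q.eval z ∧
      S'.eval z = I * deriv u x * S.eval z + 2 * I * Q.eval z ∧
      Q'.eval z = I * (z * S.eval z - z * P.eval z) := by
    intro z hz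
    have hz' : z * z⁻¹ = 1 := mul_inv_cancel₀ hz
    have hzc := hst.zero_curvature z hz x
    have dP := ((hasDerivAt_eval_coeffPoly φ g z x).const_mul z⁻¹).deriv
    have dQ := ((hasDerivAt_eval_coeffPoly χ g z x).const_mul z⁻¹).deriv
    have dS := (hasDerivAt_eval_coeffPoly η g z x).deriv
    simp only [hmat z hz] at hzc
    rw [← hP'] at dP
    rw [← hQ'] at dQ
    rw [← hS'] at dS
    have h00 := congrFun (congrFun hzc 0) 0
    have h01 := congrFun (congrFun hzc 0) 1
    have h10 := congrFun (congrFun hzc 1) 0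
    simp [sgMatU, dP, dQ, dS, ← hP, ← hQ, ← hS] at h00 h01 h10
    refine ⟨?_, ?_, ?_⟩
    · linear_combination -z * h01 - (P'.eval z + I * deriv u x * P.eval z + 2 * I * Q.eval z) * hz'
    · linear_combination -h10 + 2 * I * Q.eval z * hz'
    · linear_combination z * h00 - (Q'.eval z + I * z * P.eval z) * hz'
  refine ⟨eq_of_eval_eq_of_ne_zero fun z hz => ?_, eq_of_eval_eq_of_ne_zero fun z hz => ?_,
    eq_of_eval_eq_of_ne_zero fun z hz => ?_⟩
  · simp only [eval_add, eval_mul, eval_C]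
    linear_combination (entries z hz).1
  · simp only [eval_add, eval_mul, eval_C]
    linear_combination (entries z hz).2.1
  · simp only [eval_sub, eval_mul, eval_C, eval_X]
    exact (entries z hz).2.2

theorem sg_eval {g : ℕ} (r : ℕ) (j : Fin g) (u : ℝ → ℂ) (α β : ℂ) (f h γ : ℕ → ℝ → ℂ)
    (E : Fin (2 * g + 1) → ℂ) (x₀ : ℝ) (hst : IsStationarySG g u α β f h γ)
    (hR : sgR g f h γ x₀ = ∏ m, (X - C (E m))) (x : ℝ) :
    (α ≠ 0 → ∀ (α' : ℂ) (μ : Fin g → ℂ), sgF g f x = ∏ l, (X - C (μ l)) →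
      μ j ≠ 0 ∧ (sgFHat u α' r x).eval (μ j) / μ j
        = ∑ p ∈ Finset.Ico (r - 1 - g) r, cCoeff p E * Phi (r - 1 - p) j μ
          - α' / α * Phi (g - 1) j μ) ∧
    (β ≠ 0 → ∀ (β' : ℂ) (ν : Fin g → ℂ), sgF g h x = ∏ l, (X - C (ν l)) →
      ν j ≠ 0 ∧ (sgHHat u β' r x).eval (ν j) / ν j
        = ∑ p ∈ Finset.Ico (r - 1 - g) r, cCoeff p E * Phi (r - 1 - p) j ν
          - β' / β * Phi (g - 1) j ν) := by
  let φ : ℕ → SmoothFun := fun k => ⟨f k, hst.smooth_f k⟩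
  let η : ℕ → SmoothFun := fun k => ⟨h k, hst.smooth_h k⟩
  let χ : ℕ → SmoothFun := fun k => if k < g then ⟨γ k, hst.smooth_g k⟩ else 0
  have hφ : ∀ k y, SmoothFun.ev y (φ k) = f k y := fun k y => rfl
  have hη : ∀ k y, SmoothFun.ev y (η k) = h k y := fun k y => rfl
  have hχ : ∀ k y, SmoothFun.ev y (χ k) = if k < g then γ k y else 0 := by
    intro k y
    simp only [χ]
    split_ifs
    · rfl
    · exact map_zero _
  let U : SmoothFun := SmoothFun.D ⟨u, hst.smooth_u⟩
  let i : SmoothFun := algebraMap ℂ SmoothFun I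
  have hevU : ∀ y, SmoothFun.ev y U = deriv u y := fun y => rfl
  have hevDU : ∀ y, SmoothFun.ev y (SmoothFun.D U) = iteratedDeriv 2 u y := fun y =>
    SmoothFun.ev_iterate_D y 2 ⟨u, hst.smooth_u⟩
  have hevi : ∀ y, SmoothFun.ev y i = I := fun y => rfl
  have hrev : ∀ (s : ℕ → SmoothFun) (y : ℝ),
      PowerSeries.map (SmoothFun.ev y : SmoothFun →+* ℂ) (truncSeries g s)
        = revSeries g (coeffPoly (fun k => SmoothFun.ev y (s k)) g) := by
    intro s y
    rw [map_truncSeries, revSeries_coeffPoly]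
    rfl
  have hcoe : ∀ (y : ℝ) (s : SmoothFun), (SmoothFun.ev y : SmoothFun →+* ℂ) s = SmoothFun.ev y s :=
    fun _ _ => rfl
  have hP : psD SmoothFun.D (truncSeries g φ) = -(PowerSeries.C (i * U) * truncSeries g φ)
      - 2 * PowerSeries.C i * truncSeries g χ := by
    apply SmoothFun.ext_map_ev
    intro y
    have key := congrArg (revSeries g) (sg_zeroCurvature hst hφ hη hχ y rfl rfl rfl rfl rfl rfl).1
    rw [revSeries_add, revSeries_C_mul, revSeries_C_mul] at key
    simp only [psD_truncSeries, map_sub, map_neg, map_mul, hrev, PowerSeries.map_C, map_ofNat, hcoe,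
      hevi, hevU] at key ⊢
    linear_combination key
  have hS : psD SmoothFun.D (truncSeries g η) = PowerSeries.C (i * U) * truncSeries g η
      + 2 * PowerSeries.C i * truncSeries g χ := by
    apply SmoothFun.ext_map_ev
    intro y
    have key := congrArg (revSeries g) (sg_zeroCurvature hst hφ hη hχ y rfl rfl rfl rfl rfl rfl).2.1
    rw [revSeries_add, revSeries_C_mul, revSeries_C_mul] at key
    simp only [psD_truncSeries, map_add, map_mul, hrev, PowerSeries.map_C, map_ofNat, hcoe,
      hevi, hevU] at key ⊢
    linear_combination key
  have hQ : PowerSeries.X * psD SmoothFun.D (truncSeries g χ)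
      = PowerSeries.C i * (truncSeries g η - truncSeries g φ) := by
    apply SmoothFun.ext_map_ev
    intro y
    have key := congrArg (revSeries (g + 1))
      (sg_zeroCurvature hst hφ hη hχ y rfl rfl rfl rfl rfl rfl).2.2
    rw [revSeries_C_mul, revSeries_sub, revSeries_X_mul (natDegree_coeffPoly_le _ _),
      revSeries_X_mul (natDegree_coeffPoly_le _ _), revSeries_succ (natDegree_coeffPoly_le _ _)]
      at key
    simp only [psD_truncSeries, map_sub, map_mul, hrev, PowerSeries.map_C, PowerSeries.map_X, hcoe,
      hevi]
    exact key
  have hRser : PowerSeries.map (SmoothFun.ev x₀ : SmoothFun →+* ℂ)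
      (PowerSeries.X * (truncSeries g χ * truncSeries g χ) + truncSeries g φ * truncSeries g η)
      = branchSeries Finset.univ E := by
    have hsplit : sgR g f h γ x₀ = (X * sgG g γ x₀) * (X * sgG g γ x₀)
        + X * (sgF g f x₀ * sgF g h x₀) := by
      rw [sgR]; ring
    rw [← revSeries_prod_univ, ← hR, hsplit, X_mul_sgG, sgF, sgF, two_mul, revSeries_add,
      revSeries_X_mul (natDegree_mul_le_of_le (natDegree_coeffPoly_le _ _)
        (natDegree_coeffPoly_le _ _)),
      revSeries_succ (natDegree_mul_le_of_le (natDegree_coeffPoly_le _ _)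
        (natDegree_coeffPoly_le _ _)),
      revSeries_mul (natDegree_coeffPoly_le _ _) (natDegree_coeffPoly_le _ _),
      revSeries_mul (natDegree_coeffPoly_le _ _) (natDegree_coeffPoly_le _ _)]
    simp only [map_add, map_mul, PowerSeries.map_X, hrev, hφ, hη, hχ]
  have hφ0 : φ 0 = 1 := SmoothFun.ext_ev fun y => by rw [hφ, hst.f_zero, map_one]
  have hη0 : η 0 = 1 := SmoothFun.ext_ev fun y => by rw [hη, hst.h_zero, map_one]
  constructor
  · intro hα α' μ hμ
    let W : SmoothFun := algebraMap ℂ SmoothFun (-(1 / 4)) * (U ^ 2 + 2 * i * SmoothFun.D U)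
    have hW : (W : ℝ → ℂ) = wPlus u := by
      funext y
      rw [← SmoothFun.ev_apply]
      simp only [W, map_mul, map_add, map_pow, hevU, hevDU, hevi, map_ofNat, AlgHom.commutes]
      rfl
    have h4W : 4 * W = -(U ^ 2 + 2 * i * SmoothFun.D U) := by
      apply SmoothFun.ext_ev
      intro y
      simp only [W, map_mul, map_add, map_neg, map_ofNat, AlgHom.commutes, Algebra.algebraMap_self,
        RingHom.id_apply]
      ring
    have hser := sg_series rfl h4W hP hS hQ (by rw [constantCoeff_truncSeries, hφ0]) hRser x
    rw [hW, map_truncSeries] at hser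
    exact sg_eval_of_series r j E μ _ (fun k => f k x) hα (exp_ne_zero _) (hst.f_last x) α' hμ hser
  · intro hβ β' ν hν
    let W : SmoothFun := algebraMap ℂ SmoothFun (-(1 / 4)) * (U ^ 2 - 2 * i * SmoothFun.D U)
    have hW : (W : ℝ → ℂ) = wMinus u := by
      funext y
      rw [← SmoothFun.ev_apply]
      simp only [W, map_mul, map_sub, map_pow, hevU, hevDU, hevi, map_ofNat, AlgHom.commutes]
      rfl
    have h4W : 4 * W = -((-U) ^ 2 + 2 * i * SmoothFun.D (-U)) := by
      apply SmoothFun.ext_ev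
      intro y
      simp only [W, map_mul, map_add, map_sub, map_pow, map_neg, map_ofNat, AlgHom.commutes,
        Algebra.algebraMap_self, RingHom.id_apply]
      ring
    obtain ⟨hS', hP', hQ', hform⟩ := sg_flip SmoothFun.D hP hS hQ
    have hser := sg_series (U := -U) (F := truncSeries g η) (G := -truncSeries g χ)
      (H := truncSeries g φ) rfl h4W hS' hP' hQ' (by rw [constantCoeff_truncSeries, hη0])
      ((congrArg _ hform).trans hRser) x
    rw [hW, map_truncSeries] at hser
    exact sg_eval_of_series r j E ν _ (fun k => h k x) hβ (exp_ne_zero _) (hst.h_last x) β' hν hser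

/-! ### AKNS -/

/-- The quadratic form `G² - w² F H`. -/
def aknsForm {A : Type} [CommRing A] (F G H : PowerSeries A) : PowerSeries A :=
  G * G - PowerSeries.X * (PowerSeries.X * (F * H))

theorem map_aknsForm {A B : Type} [CommRing A] [CommRing B] (φ : A →+* B)
    (F G H : PowerSeries A) :
    PowerSeries.map φ (aknsForm F G H)
      = aknsForm (PowerSeries.map φ F) (PowerSeries.map φ G) (PowerSeries.map φ H) := by
  simp only [aknsForm, map_sub, map_mul, PowerSeries.map_X]

section aknsForm
variable {A : Type} [CommRing A] [Algebra ℂ A]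

/-- The differential equations of the AKNS recursion for generating series `F`, `G`, `H` in
`w = 1/z`, where `i` plays the role of the imaginary unit. -/
structure IsAKNSSeries (D : Derivation ℂ A A) (i p q : A) (F G H : PowerSeries A) : Prop where
  eq_F : PowerSeries.X * psD D F = 2 * PowerSeries.C q * G - 2 * PowerSeries.C i * F
  eq_G : psD D G = PowerSeries.X * (PowerSeries.C p * F + PowerSeries.C q * H)
  eq_H : PowerSeries.X * psD D H = 2 * PowerSeries.C p * G + 2 * PowerSeries.C i * H

namespace IsAKNSSeries
variable {D : Derivation ℂ A A} {i p q : A} {F G H : PowerSeries A}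

theorem of_rec {f g h : ℕ → A} (hf0 : q * g 0 = i * f 0) (hh0 : p * g 0 = -(i * h 0))
    (hg0 : D (g 0) = 0) (hf : ∀ n, D (f n) = 2 * q * g (n + 1) - 2 * i * f (n + 1))
    (hg : ∀ n, D (g (n + 1)) = p * f n + q * h n)
    (hh : ∀ n, D (h n) = 2 * p * g (n + 1) + 2 * i * h (n + 1)) :
    IsAKNSSeries D i p q (PowerSeries.mk f) (PowerSeries.mk g) (PowerSeries.mk h) := by
  have k2 : (2 : PowerSeries A) = PowerSeries.C 2 := (map_ofNat _ _).symm
  refine ⟨?_, ?_, ?_⟩ <;> ext1 n <;> cases n with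
  | zero => ?_
  | succ n => ?_
  · simp [k2, mul_assoc, hf0]
  · simp [k2, mul_assoc, psD_coeff, PowerSeries.coeff_succ_X_mul, hf]
  · simp [psD_coeff, hg0]
  · simp [psD_coeff, PowerSeries.coeff_succ_X_mul, hg]
  · simp [k2, mul_assoc, hh0]
  · simp [k2, mul_assoc, psD_coeff, PowerSeries.coeff_succ_X_mul, hh]

/-- The form is a first integral. -/
theorem psD_aknsForm (h : IsAKNSSeries D i p q F G H) : psD D (aknsForm F G H) = 0 := by
  simp only [aknsForm, psD_sub, psD_mul, psD_X]
  linear_combination 2 * G * h.eq_G - PowerSeries.X * F * h.eq_H - PowerSeries.X * H * h.eq_F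

theorem map {B : Type} [CommRing B] [Algebra ℂ B] {D' : Derivation ℂ B B} {φ : A →+* B}
    (hφ : ∀ a, D' (φ a) = φ (D a)) (h : IsAKNSSeries D i p q F G H) :
    IsAKNSSeries D' (φ i) (φ p) (φ q) (PowerSeries.map φ F) (PowerSeries.map φ G)
      (PowerSeries.map φ H) := by
  refine ⟨?_, ?_, ?_⟩
  · simpa [psD_map hφ, map_ofNat] using congrArg (PowerSeries.map φ) h.eq_F
  · simpa [psD_map hφ, map_ofNat] using congrArg (PowerSeries.map φ) h.eq_G
  · simpa [psD_map hφ, map_ofNat] using congrArg (PowerSeries.map φ) h.eq_H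

theorem const_mul {c : PowerSeries A} (hc : psD D c = 0) (h : IsAKNSSeries D i p q F G H) :
    IsAKNSSeries D i p q (c * F) (c * G) (c * H) := by
  refine ⟨?_, ?_, ?_⟩ <;> rw [psD_mul, hc]
  · linear_combination c * h.eq_F
  · linear_combination c * h.eq_G
  · linear_combination c * h.eq_H

/-- The quadratic form and the constant coefficient of `G` determine a solution: the form gives the
next coefficient of `G` from the earlier ones of `F` and `H`, and the differential equations then
give the next coefficients of `F` and `H`. -/
theorem unique (hi : i * i = -1) {F' G' H' : PowerSeries A} (h : IsAKNSSeries D i p q F G H)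
    (h' : IsAKNSSeries D i p q F' G' H') (hG : PowerSeries.constantCoeff G = 1)
    (hG' : PowerSeries.constantCoeff G' = 1) (hQ : aknsForm F G H = aknsForm F' G' H') :
    F = F' ∧ H = H' := by
  have hu : IsUnit (G + G') := by
    rw [PowerSeries.isUnit_iff_constantCoeff, map_add, hG, hG', one_add_one_eq_two]
    exact isUnit_ofNat 2
  have hu2 : IsUnit (2 * PowerSeries.C i) := by
    refine (isUnit_ofNat (A := PowerSeries A) 2).mul (IsUnit.map _ ?_)
    exact isUnit_iff_exists_inv.2 ⟨-i, by rw [mul_neg, hi, neg_neg]⟩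
  have key : ∀ n, PowerSeries.X ^ n ∣ F - F' ∧ PowerSeries.X ^ n ∣ H - H' := by
    intro n
    induction n with
    | zero => simp
    | succ n ih =>
      have dG : PowerSeries.X ^ (n + 1) ∣ G - G' := by
        have e : (G + G') * (G - G')
            = PowerSeries.X * (PowerSeries.X * (F * (H - H') + (F - F') * H')) := by
          simp only [aknsForm] at hQ
          linear_combination hQ
        rw [← hu.dvd_mul_left, e, pow_succ']
        exact mul_dvd_mul_left _ ((dvd_add (ih.2.mul_left _) (ih.1.mul_right _)).mul_left _)
      constructor
      · have e : 2 * PowerSeries.C i * (F - F')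
            = 2 * PowerSeries.C q * (G - G') - PowerSeries.X * psD D (F - F') := by
          rw [psD_sub]
          linear_combination h.eq_F - h'.eq_F
        rw [← hu2.dvd_mul_left, e]
        refine dvd_sub (dG.mul_left _) ?_
        rw [pow_succ']
        exact mul_dvd_mul_left _ (X_pow_dvd_psD D ih.1)
      · have e : 2 * PowerSeries.C i * (H - H')
            = PowerSeries.X * psD D (H - H') - 2 * PowerSeries.C p * (G - G') := by
          rw [psD_sub]
          linear_combination h'.eq_H - h.eq_H
        rw [← hu2.dvd_mul_left, e]
        refine dvd_sub ?_ (dG.mul_left _)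
        rw [pow_succ']
        exact mul_dvd_mul_left _ (X_pow_dvd_psD D ih.2)
  exact ⟨eq_of_forall_X_pow_dvd fun n => (key n).1, eq_of_forall_X_pow_dvd fun n => (key n).2⟩

end IsAKNSSeries
end aknsForm

theorem isAKNSSeries_hat : IsAKNSSeries DiffPoly₂.D (MvPolynomial.C I)
    (MvPolynomial.X (Sum.inl 0)) (MvPolynomial.X (Sum.inr 0))
    (PowerSeries.mk aknsHatF) (PowerSeries.mk aknsHatG) (PowerSeries.mk aknsHatH) := by
  have hs := aknsHat_spec
  have hI : (MvPolynomial.C I : DiffPoly₂) * MvPolynomial.C I = -1 := by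
    rw [← MvPolynomial.C_mul]; simp
  have e : (2 : DiffPoly₂) * MvPolynomial.C (I / 2) = MvPolynomial.C I := by
    rw [show (2 : DiffPoly₂) = MvPolynomial.C 2 from (map_ofNat _ _).symm, ← MvPolynomial.C_mul]
    congr 1; ring
  apply IsAKNSSeries.of_rec
  · rw [hs.g_zero, hs.f_zero, map_neg]
    linear_combination MvPolynomial.X (Sum.inr 0) * hI
  · rw [hs.g_zero, hs.h_zero]
    linear_combination MvPolynomial.X (Sum.inl 0) * hI
  · rw [hs.g_zero, Derivation.map_one_eq_zero]
  · intro n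
    rw [hs.f_succ n]
    linear_combination (-2 * MvPolynomial.X (Sum.inr 0) * aknsHatG (n + 1)
      + DiffPoly₂.D (aknsHatF n)) * hI + MvPolynomial.C I * DiffPoly₂.D (aknsHatF n) * e
  · exact hs.g_succ
  · intro n
    rw [hs.h_succ n, map_neg]
    linear_combination (-2 * MvPolynomial.X (Sum.inl 0) * aknsHatG (n + 1)
      + DiffPoly₂.D (aknsHatH n)) * hI + MvPolynomial.C I * DiffPoly₂.D (aknsHatH n) * e

/-- The form of the homogeneous series is a constant, which can be read off after setting all jet
variables to zero. -/
theorem aknsForm_hat : aknsForm (PowerSeries.mk aknsHatF) (PowerSeries.mk aknsHatG)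
    (PowerSeries.mk aknsHatH) = 1 := by
  have hs := aknsHat_spec
  have hD := isAKNSSeries_hat.psD_aknsForm
  have hF : PowerSeries.map MvPolynomial.constantCoeff (PowerSeries.mk aknsHatF) = 0 := by
    ext n
    cases n with
    | zero => simp [hs.f_zero]
    | succ n => simp [hs.f_succ n, constantCoeff_totalDeriv]
  have hG : PowerSeries.map MvPolynomial.constantCoeff (PowerSeries.mk aknsHatG) = 1 := by
    ext n
    cases n with
    | zero => simp [hs.g_zero]
    | succ n => simp [hs.g_const n, PowerSeries.coeff_one]
  have h1 : PowerSeries.map MvPolynomial.constantCoeff (aknsForm (PowerSeries.mk aknsHatF)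
      (PowerSeries.mk aknsHatG) (PowerSeries.mk aknsHatH)) = 1 := by
    rw [map_aknsForm, hF, hG]
    simp [aknsForm]
  ext1 n
  have hn := congrArg (PowerSeries.coeff n) hD
  rw [psD_coeff, map_zero] at hn
  have h1n := congrArg (PowerSeries.coeff n) h1
  rw [PowerSeries.coeff_map, PowerSeries.coeff_one] at h1n
  rw [DiffPoly₂.eq_C hn, h1n, PowerSeries.coeff_one]
  split_ifs
  · exact map_one _
  · exact map_zero _

/-- The homogeneous AKNS coefficients are `∏ (1 - E_m w)^{-1/2}` times any solution of the
differential equations for which the quadratic form is `∏ (1 - E_m w)`. -/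
theorem aknsHat_series {M : ℕ} {p q : SmoothFun} {E : Fin M → ℂ} {F G H : PowerSeries SmoothFun}
    (h : IsAKNSSeries SmoothFun.D (algebraMap ℂ SmoothFun I) p q F G H)
    (hG : PowerSeries.constantCoeff G = 1)
    (hQ : aknsForm F G H
      = PowerSeries.map (algebraMap ℂ SmoothFun) (branchSeries Finset.univ E)) (x : ℝ) :
    PowerSeries.mk (fun k => evalJet₂ p q x (aknsHatF k))
      = cSeries E * PowerSeries.map (SmoothFun.ev x) F ∧
    PowerSeries.mk (fun k => evalJet₂ p q x (aknsHatH k))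
      = cSeries E * PowerSeries.map (SmoothFun.ev x) H := by
  let φ : DiffPoly₂ →ₐ[ℂ] SmoothFun := MvPolynomial.aeval
    (Sum.elim (fun k => SmoothFun.D^[k] p) (fun k => SmoothFun.D^[k] q))
  have hφ : ∀ P, SmoothFun.D (φ P) = φ (DiffPoly₂.D P) := by
    refine derivation_aeval SmoothFun.D fun k => ?_
    cases k <;> exact (Function.iterate_succ_apply' _ _ _).symm
  have hev : ∀ P, evalJet₂ p q x P = SmoothFun.ev x (φ P) := by
    intro P
    simp only [φ, evalJet₂, ← AlgHom.comp_apply, MvPolynomial.comp_aeval]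
    congr 2
    funext k
    cases k <;> exact (SmoothFun.ev_iterate_D x _ _).symm
  have h1 := isAKNSSeries_hat.map (D' := SmoothFun.D) (φ := (φ : DiffPoly₂ →+* SmoothFun)) hφ
  have hI : (φ : DiffPoly₂ →+* SmoothFun) (MvPolynomial.C I) = algebraMap ℂ SmoothFun I :=
    φ.commutes I
  have hp : (φ : DiffPoly₂ →+* SmoothFun) (MvPolynomial.X (Sum.inl 0)) = p := by simp [φ]
  have hq : (φ : DiffPoly₂ →+* SmoothFun) (MvPolynomial.X (Sum.inr 0)) = q := by simp [φ]
  rw [hI, hp, hq] at h1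
  have key := h1.unique (by rw [← map_mul, I_mul_I, map_neg, map_one])
    (h.const_mul (psD_map_algebraMap SmoothFun.D (cSeries E)))
    (by rw [constantCoeff_map, PowerSeries.constantCoeff_mk, aknsHat_spec.g_zero, map_one])
    (by rw [map_mul, hG, constantCoeff_map, constantCoeff_cSeries, map_one, one_mul])
    (by
      have hc := congrArg (PowerSeries.map (algebraMap ℂ SmoothFun)) (cSeries_sq E)
      rw [map_mul, map_pow, map_one, ← hQ] at hc
      rw [← map_aknsForm, aknsForm_hat, map_one, ← hc]
      simp only [aknsForm]
      ring)
  constructor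
  · have h2 := congrArg (PowerSeries.map (SmoothFun.ev x : SmoothFun →+* ℂ)) key.1
    rw [map_mul, SmoothFun.map_ev_algebraMap] at h2
    rw [← h2]
    ext k
    simp [hev]
  · have h2 := congrArg (PowerSeries.map (SmoothFun.ev x : SmoothFun →+* ℂ)) key.2
    rw [map_mul, SmoothFun.map_ev_algebraMap] at h2
    rw [← h2]
    ext k
    simp [hev]

theorem akns_eval {g : ℕ} (r : ℕ) (j : Fin g) (p q : ℝ → ℂ) (f γ h : ℕ → ℝ → ℂ)
    (E : Fin (2 * g + 2) → ℂ) (x₀ : ℝ) (hst : IsStationaryAKNS g p q f γ h)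
    (hR : aknsR g f γ h x₀ = ∏ m, (X - C (E m))) (x : ℝ) :
    (∀ μ : Fin g → ℂ, aknsF g f x = C (-I * q x) * ∏ l, (X - C (μ l)) →
      (aknsFHat p q r x).eval (μ j)
        = -I * q x * ∑ k ∈ Finset.Icc (r - g) r, cCoeff k E * Phi (r - k) j μ) ∧
    (∀ ν : Fin g → ℂ, aknsF g h x = C (I * p x) * ∏ l, (X - C (ν l)) →
      (aknsHHat p q r x).eval (ν j)
        = I * p x * ∑ k ∈ Finset.Icc (r - g) r, cCoeff k E * Phi (r - k) j ν) := by
  let φ : ℕ → SmoothFun := fun k => ⟨f k, hst.smooth_f k⟩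
  let χ : ℕ → SmoothFun := fun k => ⟨γ k, hst.smooth_g k⟩
  let η : ℕ → SmoothFun := fun k => ⟨h k, hst.smooth_h k⟩
  let p' : SmoothFun := ⟨p, hst.smooth_p⟩
  let q' : SmoothFun := ⟨q, hst.smooth_q⟩
  let i : SmoothFun := algebraMap ℂ SmoothFun I
  have eφ : ∀ k y, SmoothFun.ev y (φ k) = f k y := fun _ _ => rfl
  have eχ : ∀ k y, SmoothFun.ev y (χ k) = γ k y := fun _ _ => rfl
  have eη : ∀ k y, SmoothFun.ev y (η k) = h k y := fun _ _ => rfl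
  have ep : ∀ y, SmoothFun.ev y p' = p y := fun _ => rfl
  have eq : ∀ y, SmoothFun.ev y q' = q y := fun _ => rfl
  have ei : ∀ y, SmoothFun.ev y i = I := fun _ => rfl
  have dφ : ∀ k y, SmoothFun.ev y (SmoothFun.D (φ k)) = deriv (f k) y := fun _ _ => rfl
  have dχ : ∀ k y, SmoothFun.ev y (SmoothFun.D (χ k)) = deriv (γ k) y := fun _ _ => rfl
  have dη : ∀ k y, SmoothFun.ev y (SmoothFun.D (η k)) = deriv (h k) y := fun _ _ => rfl
  have hχ0 : χ 0 = 1 := SmoothFun.ext_ev fun y => by rw [eχ, hst.g_zero, map_one]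
  have hφlast : φ (g + 1) = 0 := SmoothFun.ext_ev fun y => by rw [eφ, hst.stationary_f, map_zero]
  have hηlast : η (g + 1) = 0 := SmoothFun.ext_ev fun y => by rw [eη, hst.stationary_h, map_zero]
  have rφ : ∀ n, SmoothFun.D (φ n) = 2 * q' * χ (n + 1) - 2 * i * φ (n + 1) := fun n => by
    apply SmoothFun.ext_ev
    intro y
    simp only [map_sub, map_mul, map_ofNat, dφ, eφ, eχ, eq, ei]
    rw [hst.f_succ n y]
    linear_combination (-2 * q y * γ (n + 1) y + deriv (f n) y) * I_mul_I
  have rη : ∀ n, SmoothFun.D (η n) = 2 * p' * χ (n + 1) + 2 * i * η (n + 1) := fun n => by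
    apply SmoothFun.ext_ev
    intro y
    simp only [map_add, map_mul, map_ofNat, dη, eη, eχ, ep, ei]
    rw [hst.h_succ n y]
    linear_combination (-2 * p y * γ (n + 1) y + deriv (h n) y) * I_mul_I
  have rχ : ∀ n, SmoothFun.D (χ (n + 1)) = p' * φ n + q' * η n := fun n => by
    apply SmoothFun.ext_ev
    intro y
    simp only [map_add, map_mul, dχ, eφ, eη, ep, eq]
    exact hst.g_succ n y
  have hser : IsAKNSSeries SmoothFun.D i p' q' (truncSeries g φ) (truncSeries (g + 1) χ)
      (truncSeries g η) := by
    apply IsAKNSSeries.of_rec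
    · rw [if_pos (Nat.zero_le _), if_pos (Nat.zero_le _), hχ0]
      apply SmoothFun.ext_ev
      intro y
      simp only [map_mul, map_one, eφ, eq, ei, hst.f_zero]
      linear_combination q y * I_mul_I
    · rw [if_pos (Nat.zero_le _), if_pos (Nat.zero_le _), hχ0]
      apply SmoothFun.ext_ev
      intro y
      simp only [map_mul, map_neg, map_one, eη, ep, ei, hst.h_zero]
      linear_combination p y * I_mul_I
    · rw [if_pos (Nat.zero_le _), hχ0, Derivation.map_one_eq_zero]
    · intro n
      rcases lt_trichotomy n g with hn | rfl | hn
      · rw [if_pos hn.le, if_pos (by omega), if_pos (by omega), rφ]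
      -- The truncation is consistent because `f_{g+1} = 0`.
      · rw [if_pos le_rfl, if_pos le_rfl, if_neg (by omega), rφ, hφlast]
      · rw [if_neg (by omega), if_neg (by omega), if_neg (by omega)]
        simp
    · intro n
      by_cases hn : n ≤ g
      · rw [if_pos (by omega), if_pos hn, if_pos hn, rχ]
      · rw [if_neg (by omega), if_neg hn, if_neg hn]
        simp
    · intro n
      rcases lt_trichotomy n g with hn | rfl | hn
      · rw [if_pos hn.le, if_pos (by omega), if_pos (by omega), rη]
      -- The truncation is consistent because `h_{g+1} = 0`.
      · rw [if_pos le_rfl, if_pos le_rfl, if_neg (by omega), rη, hηlast]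
      · rw [if_neg (by omega), if_neg (by omega), if_neg (by omega)]
        simp
  have hrev : ∀ (n : ℕ) (s : ℕ → SmoothFun) (y : ℝ),
      PowerSeries.map (SmoothFun.ev y : SmoothFun →+* ℂ) (truncSeries n s)
        = revSeries n (coeffPoly (fun k => SmoothFun.ev y (s k)) n) := by
    intro n s y
    rw [map_truncSeries, revSeries_coeffPoly]
    rfl
  have hRser : PowerSeries.map (SmoothFun.ev x₀ : SmoothFun →+* ℂ)
      (aknsForm (truncSeries g φ) (truncSeries (g + 1) χ) (truncSeries g η))
      = branchSeries Finset.univ E := by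
    have dFH : (coeffPoly (fun k => f k x₀) g * coeffPoly (fun k => h k x₀) g).natDegree ≤ g + g :=
      natDegree_mul_le_of_le (natDegree_coeffPoly_le _ _) (natDegree_coeffPoly_le _ _)
    rw [← revSeries_prod_univ, ← hR, aknsR, aknsF, aknsF, revSeries_sub, pow_two,
      show 2 * g + 2 = g + g + 1 + 1 by ring, revSeries_succ (dFH.trans (Nat.le_succ _)),
      revSeries_succ dFH, revSeries_mul (natDegree_coeffPoly_le _ _) (natDegree_coeffPoly_le _ _),
      show g + g + 1 + 1 = (g + 1) + (g + 1) by ring,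
      revSeries_mul (natDegree_coeffPoly_le _ _) (natDegree_coeffPoly_le _ _), map_aknsForm]
    simp only [hrev, eφ, eχ, eη, aknsForm]
  have hmain := aknsHat_series hser (by rw [constantCoeff_truncSeries, hχ0])
    (SmoothFun.eq_map_algebraMap hser.psD_aknsForm hRser) x
  rw [map_truncSeries, map_truncSeries] at hmain
  constructor
  · intro μ hμ
    exact eval_coeffPoly r j E μ _ _
      (hmain.1.trans (congrArg _ (truncSeries_eq_of_coeffPoly_eq hμ)))
  · intro ν hν
    exact eval_coeffPoly r j E ν _ _
      (hmain.2.trans (congrArg _ (truncSeries_eq_of_coeffPoly_eq hν)))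

/-! ### Toda -/

section todaForm
variable {A : Type} [CommRing A]

/-- The difference equations of the Toda recursion for generating series in `w = 1/z`; `σ` and `τ`
are the shifts by `-1` and `1`, and `G` has constant coefficient `-1`, like
`w^{g+1} G_{g+1}(1/w)`. -/
structure IsTodaSeries (σ τ : A →+* A) (a b : A) (F G : PowerSeries A) : Prop where
  eq_F : G + PowerSeries.map σ G = -2 * (1 + PowerSeries.C b * PowerSeries.X) * F
  eq_G : (1 + PowerSeries.C b * PowerSeries.X) * (G - PowerSeries.map σ G)
    + 2 * PowerSeries.X ^ 2 * (PowerSeries.C (a ^ 2) * PowerSeries.map τ F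
      - PowerSeries.C (σ a ^ 2) * PowerSeries.map σ F) = 0
  constantCoeff_G : PowerSeries.constantCoeff G = -1

/-- The quadratic form `G² - 4 a² w² F F⁺`. -/
def todaForm (τ : A →+* A) (a : A) (F G : PowerSeries A) : PowerSeries A :=
  G * G - PowerSeries.C (4 * a ^ 2) * (PowerSeries.X * (PowerSeries.X * (F * PowerSeries.map τ F)))

theorem map_todaForm {B : Type} [CommRing B] {φ : A →+* B} {τ : A →+* A} {τ' : B →+* B}
    (h : ∀ x, τ' (φ x) = φ (τ x)) (a : A) (F G : PowerSeries A) :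
    PowerSeries.map φ (todaForm τ a F G)
      = todaForm τ' (φ a) (PowerSeries.map φ F) (PowerSeries.map φ G) := by
  have : PowerSeries.map τ' (PowerSeries.map φ F) = PowerSeries.map φ (PowerSeries.map τ F) := by
    ext n; simp [h]
  simp only [todaForm, map_sub, map_mul, map_pow, map_ofNat, PowerSeries.map_X, PowerSeries.map_C,
    this]

namespace IsTodaSeries
variable {σ τ : A →+* A} {a b : A} {F G : PowerSeries A}

theorem of_rec {f g : ℕ → A} (f0 : f 0 = 1) (g0 : g 0 - σ (g 0) = 0)
    (hf : ∀ n, 2 * f (n + 1) + g n + σ (g n) + 2 * b * f n = 0)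
    (hg : ∀ n, g (n + 1) - σ (g (n + 1)) + 2 * (a ^ 2 * τ (f n) - σ a ^ 2 * σ (f n))
      + b * (g n - σ (g n)) = 0) :
    IsTodaSeries σ τ a b (PowerSeries.mk f) (-1 + PowerSeries.X * PowerSeries.mk g) := by
  have k2 : (2 : PowerSeries A) = PowerSeries.C 2 := (map_ofNat _ _).symm
  have eσ : PowerSeries.map σ (-1 + PowerSeries.X * PowerSeries.mk g)
      = -1 + PowerSeries.X * PowerSeries.map σ (PowerSeries.mk g) := by
    rw [map_add, map_neg, map_one, map_mul, PowerSeries.map_X]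
  have e1 : 2 * PowerSeries.mk f + PowerSeries.X * (PowerSeries.mk g
      + PowerSeries.map σ (PowerSeries.mk g) + 2 * (PowerSeries.C b * PowerSeries.mk f)) = 2 := by
    rw [k2]
    ext1 n
    cases n with
    | zero => simp [f0]
    | succ n =>
      rw [map_add, PowerSeries.coeff_succ_X_mul]
      simp only [map_add, PowerSeries.coeff_C_mul, PowerSeries.coeff_mk, PowerSeries.coeff_map]
      rw [PowerSeries.coeff_C, if_neg (by omega)]
      linear_combination hf n
  have e2 : PowerSeries.mk g - PowerSeries.map σ (PowerSeries.mk g)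
      + PowerSeries.X * (2 * (PowerSeries.C (a ^ 2) * PowerSeries.map τ (PowerSeries.mk f)
        - PowerSeries.C (σ a ^ 2) * PowerSeries.map σ (PowerSeries.mk f))
      + PowerSeries.C b * (PowerSeries.mk g - PowerSeries.map σ (PowerSeries.mk g))) = 0 := by
    rw [k2]
    ext1 n
    cases n with
    | zero => simpa [constantCoeff_map] using g0
    | succ n =>
      rw [map_add, PowerSeries.coeff_succ_X_mul]
      simp only [map_add, map_sub, PowerSeries.coeff_C_mul, PowerSeries.coeff_mk,
        PowerSeries.coeff_map, map_zero]
      linear_combination hg n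
  refine ⟨?_, ?_, by simp⟩
  · rw [eσ]
    linear_combination e1
  · rw [eσ]
    linear_combination PowerSeries.X * e2

/-- The form is a first integral: its difference with its shift is `2 F` times the second equation,
by the first one. -/
theorem map_todaForm_shift (h : IsTodaSeries σ τ a b F G) (hστ : ∀ x, σ (τ x) = x) :
    PowerSeries.map σ (todaForm τ a F G) = todaForm τ a F G := by
  have hF : PowerSeries.map σ (PowerSeries.map τ F) = F := by
    ext n; simp [hστ]
  have e1 : PowerSeries.C (4 * a ^ 2) = 4 * PowerSeries.C (a ^ 2) := by simp [map_ofNat]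
  have e2 : PowerSeries.C (4 * σ a ^ 2) = 4 * PowerSeries.C (σ a ^ 2) := by simp [map_ofNat]
  simp only [todaForm, map_sub, map_mul, PowerSeries.map_X, PowerSeries.map_C, hF]
  rw [← map_ofNat PowerSeries.C 4, ← map_mul] at e1
  simp only [map_pow, map_ofNat]
  have h1 := h.eq_F
  have h2 := h.eq_G
  simp only [map_pow] at h2
  linear_combination -(G - PowerSeries.map σ G) * h1 + 2 * F * h2

theorem map {B : Type} [CommRing B] {φ : A →+* B} {σ' τ' : B →+* B}
    (hσ : ∀ x, σ' (φ x) = φ (σ x)) (hτ : ∀ x, τ' (φ x) = φ (τ x)) (h : IsTodaSeries σ τ a b F G) :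
    IsTodaSeries σ' τ' (φ a) (φ b) (PowerSeries.map φ F) (PowerSeries.map φ G) := by
  have eσ : ∀ K, PowerSeries.map σ' (PowerSeries.map φ K)
      = PowerSeries.map φ (PowerSeries.map σ K) := by
    intro K; ext n; simp [hσ]
  have eτ : ∀ K, PowerSeries.map τ' (PowerSeries.map φ K)
      = PowerSeries.map φ (PowerSeries.map τ K) := by
    intro K; ext n; simp [hτ]
  refine ⟨?_, ?_, ?_⟩
  · simpa [eσ, map_ofNat] using congrArg (PowerSeries.map φ) h.eq_F
  · simpa [eσ, eτ, hσ, map_ofNat] using congrArg (PowerSeries.map φ) h.eq_G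
  · rw [constantCoeff_map, h.constantCoeff_G, map_neg, map_one]

theorem const_mul {c : PowerSeries A} (hσ : PowerSeries.map σ c = c) (hτ : PowerSeries.map τ c = c)
    (hc : PowerSeries.constantCoeff c = 1) (h : IsTodaSeries σ τ a b F G) :
    IsTodaSeries σ τ a b (c * F) (c * G) := by
  refine ⟨?_, ?_, by rw [map_mul, hc, h.constantCoeff_G, one_mul]⟩ <;>
    simp only [map_mul, hσ, hτ]
  · linear_combination c * h.eq_F
  · linear_combination c * h.eq_G

/-- The quadratic form determines a solution: it gives the next coefficient of `G` from the earlier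
ones of `F`, and the first difference equation then gives the next coefficient of `F`. -/
theorem unique [Algebra ℂ A] {F' G' : PowerSeries A} (h : IsTodaSeries σ τ a b F G)
    (h' : IsTodaSeries σ τ a b F' G') (hQ : todaForm τ a F G = todaForm τ a F' G') : F = F' := by
  have hu : IsUnit (G + G') := by
    rw [PowerSeries.isUnit_iff_constantCoeff, map_add, h.constantCoeff_G, h'.constantCoeff_G,
      ← neg_add, one_add_one_eq_two]
    exact (isUnit_ofNat 2).neg
  have hu2 : IsUnit (-2 * (1 + PowerSeries.C b * PowerSeries.X)) := by
    rw [PowerSeries.isUnit_iff_constantCoeff]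
    simpa [map_ofNat] using isUnit_ofNat (A := A) 2
  apply eq_of_forall_X_pow_dvd
  intro n
  induction n with
  | zero => simp
  | succ n ih =>
    have dG : PowerSeries.X ^ (n + 1) ∣ G - G' := by
      have e : (G + G') * (G - G') = PowerSeries.X * (PowerSeries.C (4 * a ^ 2) * (PowerSeries.X *
          (F * PowerSeries.map τ (F - F') + (F - F') * PowerSeries.map τ F'))) := by
        simp only [todaForm] at hQ
        rw [map_sub]
        linear_combination hQ
      rw [← hu.dvd_mul_left, e, pow_succ']
      exact mul_dvd_mul_left _ (((dvd_add ((X_pow_dvd_map τ ih).mul_left _)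
        (ih.mul_right _)).mul_left _).mul_left _)
    have e : -2 * (1 + PowerSeries.C b * PowerSeries.X) * (F - F')
        = (G - G') + PowerSeries.map σ (G - G') := by
      rw [map_sub]
      linear_combination h'.eq_F - h.eq_F
    rw [← hu2.dvd_mul_left, e]
    exact dvd_add dG (X_pow_dvd_map σ dG)

end IsTodaSeries
end todaForm

theorem isTodaSeries_hat : IsTodaSeries (ShiftPoly.S (-1) : ShiftPoly →+* ShiftPoly)
    (ShiftPoly.S 1 : ShiftPoly →+* ShiftPoly) (MvPolynomial.X (Sum.inl 0))
    (MvPolynomial.X (Sum.inr 0)) (PowerSeries.mk todaHatF)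
    (-1 + PowerSeries.X * PowerSeries.mk todaHatG) := by
  have hs := todaHat_spec
  have hX : (ShiftPoly.S (-1) : ShiftPoly →+* ShiftPoly) (MvPolynomial.X (Sum.inl 0))
      = MvPolynomial.X (Sum.inl (-1)) := by
    simp [ShiftPoly.S]
  apply IsTodaSeries.of_rec
  · exact hs.f_zero
  · rw [hs.g_zero, map_zero, sub_zero]
  · exact hs.f_succ
  · intro n
    rw [hX]
    exact hs.g_succ n

theorem ShiftPoly.S_neg_one_S_one (P : ShiftPoly) : ShiftPoly.S (-1) (ShiftPoly.S 1 P) = P := by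
  have hid : (fun k : ℤ => k + -1) ∘ (fun k : ℤ => k + 1) = id := by ext k; simp
  simp only [ShiftPoly.S, MvPolynomial.rename_rename]
  rw [Sum.map_comp_map, hid, Sum.map_id_id, MvPolynomial.rename_id_apply]

/-- The form of the homogeneous series is a constant, which can be read off after setting all
variables to zero. -/
theorem todaForm_hat : todaForm (ShiftPoly.S 1 : ShiftPoly →+* ShiftPoly)
    (MvPolynomial.X (Sum.inl 0)) (PowerSeries.mk todaHatF)
    (-1 + PowerSeries.X * PowerSeries.mk todaHatG) = 1 := by
  have hs := todaHat_spec
  have hσ := isTodaSeries_hat.map_todaForm_shift ShiftPoly.S_neg_one_S_one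
  have hG : PowerSeries.map MvPolynomial.constantCoeff (PowerSeries.mk todaHatG) = 0 := by
    ext n
    cases n with
    | zero => simp [hs.g_zero]
    | succ n => simp [hs.g_const n]
  have h1 : PowerSeries.map MvPolynomial.constantCoeff
      (todaForm (ShiftPoly.S 1 : ShiftPoly →+* ShiftPoly) (MvPolynomial.X (Sum.inl 0))
        (PowerSeries.mk todaHatF) (-1 + PowerSeries.X * PowerSeries.mk todaHatG)) = 1 := by
    rw [map_todaForm (τ' := RingHom.id ℂ) (fun P => by
      simp [ShiftPoly.S, MvPolynomial.constantCoeff_rename])]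
    simp only [todaForm, map_add, map_mul, hG, map_neg, map_one]
    simp
  ext1 n
  have hn := congrArg (PowerSeries.coeff n) hσ
  rw [PowerSeries.coeff_map] at hn
  have h1n := congrArg (PowerSeries.coeff n) h1
  rw [PowerSeries.coeff_map, PowerSeries.coeff_one] at h1n
  rw [ShiftPoly.eq_C hn, h1n, PowerSeries.coeff_one]
  split_ifs
  · exact map_one _
  · exact map_zero _

/-- The shift `f ↦ f(· + m)` on sequences indexed by `ℤ`. -/
def seqShift (m : ℤ) : (ℤ → ℂ) →ₐ[ℂ] (ℤ → ℂ) where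
  toFun f n := f (n + m)
  map_one' := rfl
  map_mul' _ _ := rfl
  map_zero' := rfl
  map_add' _ _ := rfl
  commutes' _ := rfl

theorem seqShift_apply (m : ℤ) (f : ℤ → ℂ) (n : ℤ) : seqShift m f n = f (n + m) := rfl

theorem map_seqShift_algebraMap (m : ℤ) (c : PowerSeries ℂ) :
    PowerSeries.map (seqShift m : (ℤ → ℂ) →+* (ℤ → ℂ))
      (PowerSeries.map (algebraMap ℂ (ℤ → ℂ)) c) = PowerSeries.map (algebraMap ℂ (ℤ → ℂ)) c := by
  ext1 n
  rw [PowerSeries.coeff_map, PowerSeries.coeff_map]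
  rfl

/-- A shift invariant series equals its value at any point. -/
theorem eq_map_algebraMap_of_shift {Q : PowerSeries (ℤ → ℂ)}
    (h : PowerSeries.map (seqShift (-1) : (ℤ → ℂ) →+* (ℤ → ℂ)) Q = Q) {q : PowerSeries ℂ} {n₀ : ℤ}
    (hq : PowerSeries.map (Pi.evalRingHom (fun _ => ℂ) n₀) Q = q) :
    Q = PowerSeries.map (algebraMap ℂ (ℤ → ℂ)) q := by
  ext1 k
  rw [PowerSeries.coeff_map, ← hq, PowerSeries.coeff_map]
  have hk := congrArg (PowerSeries.coeff k) h
  rw [PowerSeries.coeff_map] at hk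
  have hper : Function.Periodic (PowerSeries.coeff k Q) (-1) := fun n => congrFun hk n
  funext n
  have := hper.zsmul (n₀ - n) n₀
  rw [show n₀ + (n₀ - n) • (-1 : ℤ) = n by rw [smul_eq_mul]; ring] at this
  exact this

/-- The homogeneous Toda coefficients are `∏ (1 - E_m w)^{-1/2}` times any solution of the
difference equations for which the quadratic form is `∏ (1 - E_m w)`. -/
theorem todaHat_series {M : ℕ} {a b : ℤ → ℂ} {E : Fin M → ℂ} {F G : PowerSeries (ℤ → ℂ)}
    (h : IsTodaSeries (seqShift (-1) : (ℤ → ℂ) →+* (ℤ → ℂ)) (seqShift 1) a b F G)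
    (hQ : todaForm (seqShift 1) a F G
      = PowerSeries.map (algebraMap ℂ (ℤ → ℂ)) (branchSeries Finset.univ E)) (n : ℤ) :
    PowerSeries.mk (fun k => evalShift a b n (todaHatF k))
      = cSeries E * PowerSeries.map (Pi.evalRingHom (fun _ => ℂ) n) F := by
  let φ : ShiftPoly →ₐ[ℂ] (ℤ → ℂ) := MvPolynomial.aeval
    (Sum.elim (fun k m => a (m + k)) (fun k m => b (m + k)))
  have hφ : ∀ m P, seqShift m (φ P) = φ (ShiftPoly.S m P) := by
    intro m P
    have : (seqShift m).comp φ = φ.comp (ShiftPoly.S m) := by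
      apply MvPolynomial.algHom_ext
      intro k
      cases k <;> funext l <;> simp [φ, ShiftPoly.S, seqShift_apply, add_assoc, add_comm m]
    exact DFunLike.congr_fun this P
  have hev : ∀ P, evalShift a b n P = φ P n := by
    intro P
    change _ = (Pi.evalAlgHom ℂ (fun _ => ℂ) n) (φ P)
    simp only [φ, evalShift, ← AlgHom.comp_apply, MvPolynomial.comp_aeval]
    congr 2
    funext k
    cases k <;> rfl
  have h1 := isTodaSeries_hat.map (φ := (φ : ShiftPoly →+* (ℤ → ℂ)))
    (σ' := (seqShift (-1) : (ℤ → ℂ) →+* (ℤ → ℂ))) (τ' := (seqShift 1 : (ℤ → ℂ) →+* (ℤ → ℂ)))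
    (hφ (-1)) (hφ 1)
  have hQ1 := congrArg (PowerSeries.map (φ : ShiftPoly →+* (ℤ → ℂ))) todaForm_hat
  rw [map_todaForm (φ := (φ : ShiftPoly →+* (ℤ → ℂ)))
    (τ := (ShiftPoly.S 1 : ShiftPoly →+* ShiftPoly))
    (τ' := (seqShift 1 : (ℤ → ℂ) →+* (ℤ → ℂ))) (hφ 1), map_one] at hQ1
  have ha : (φ : ShiftPoly →+* (ℤ → ℂ)) (MvPolynomial.X (Sum.inl 0)) = a := by
    funext m; simp [φ]
  have hb : (φ : ShiftPoly →+* (ℤ → ℂ)) (MvPolynomial.X (Sum.inr 0)) = b := by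
    funext m; simp [φ]
  rw [ha, hb] at h1
  rw [ha] at hQ1
  have key := h1.unique (h.const_mul (map_seqShift_algebraMap _ (cSeries E))
    (map_seqShift_algebraMap _ _) (by rw [constantCoeff_map, constantCoeff_cSeries, map_one]))
    (by
      have hc := congrArg (PowerSeries.map (algebraMap ℂ (ℤ → ℂ))) (cSeries_sq E)
      rw [map_mul, map_pow, map_one, ← hQ] at hc
      rw [hQ1, ← hc]
      simp only [todaForm, map_mul, map_seqShift_algebraMap]
      ring)
  have h2 := congrArg (PowerSeries.map (Pi.evalRingHom (fun _ => ℂ) n)) key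
  have hcE : PowerSeries.map (Pi.evalRingHom (fun _ => ℂ) n)
      (PowerSeries.map (algebraMap ℂ (ℤ → ℂ)) (cSeries E)) = cSeries E := by
    ext1 k
    rw [PowerSeries.coeff_map, PowerSeries.coeff_map]
    rfl
  rw [map_mul, hcE] at h2
  rw [← h2]
  ext k
  simp [hev]

theorem toda_eval {g : ℕ} (r : ℕ) (j : Fin g) (a b : ℤ → ℂ) (f γ : ℕ → ℤ → ℂ)
    (E : Fin (2 * g + 2) → ℂ) (n₀ : ℤ) (hst : IsStationaryToda g a b f γ)
    (hR : todaR g a f γ n₀ = ∏ m, (X - C (E m))) (n : ℤ) (μ : Fin g → ℂ)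
    (hF : todaF g f n = ∏ l, (X - C (μ l))) :
    (todaFHat a b r n).eval (μ j) = ∑ p ∈ Finset.Icc (r - g) r, cCoeff p E * Phi (r - p) j μ := by
  have hg := j.pos
  -- The coefficients of `G_{g+1}` below the leading one: `f_{g+1}` is absorbed into `γ_g`.
  let χ : ℕ → ℤ → ℂ := fun k => if k = g then γ g + f (g + 1) else γ k
  have hflast : ∀ m, f (g + 1) (m - 1) = f (g + 1) m := by
    intro m
    have h1 := hst.stationary₁ (m - 1)
    rw [sub_add_cancel] at h1
    linear_combination h1 - hst.f_succ g m
  have hser : IsTodaSeries (seqShift (-1) : (ℤ → ℂ) →+* (ℤ → ℂ)) (seqShift 1) a b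
      (truncSeries g f) (-1 + PowerSeries.X * truncSeries g χ) := by
    apply IsTodaSeries.of_rec
    · rw [if_pos (Nat.zero_le _)]
      funext m
      exact hst.f_zero m
    · rw [if_pos (Nat.zero_le _), show χ 0 = γ 0 from if_neg hg.ne]
      obtain ⟨c₁, hc⟩ := hst.g_zero
      funext m
      change γ 0 m - γ 0 (m - 1) = 0
      rw [hc, hc, sub_self]
    · intro k
      rcases lt_trichotomy k g with hk | rfl | hk
      · rw [if_pos (Nat.succ_le_of_lt hk), if_pos hk.le, if_pos hk.le,
          show χ k = γ k from if_neg hk.ne]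
        funext m
        exact hst.f_succ k m
      · rw [if_neg (by omega), if_pos le_rfl, if_pos le_rfl,
          show χ k = γ k + f (k + 1) from if_pos rfl]
        funext m
        change 2 * 0 + (γ k m + f (k + 1) m) + (γ k (m - 1) + f (k + 1) (m - 1))
          + 2 * b m * f k m = 0
        have h1 := hst.stationary₁ (m - 1)
        rw [sub_add_cancel] at h1
        linear_combination h1
      · rw [if_neg (by omega), if_neg (by omega), if_neg (by omega)]
        simp
    · intro k
      rcases lt_trichotomy k g with hk | rfl | hk
      · rw [if_pos (Nat.succ_le_of_lt hk), if_pos hk.le, if_pos hk.le,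
          show χ k = γ k from if_neg hk.ne]
        funext m
        have h2 := hst.g_succ k m
        by_cases hk' : k + 1 = g
        · rw [show χ (k + 1) = γ (k + 1) + f (g + 1) by rw [hk']; exact if_pos rfl]
          change (γ (k + 1) m + f (g + 1) m) - (γ (k + 1) (m - 1) + f (g + 1) (m - 1))
            + 2 * (a m ^ 2 * f k (m + 1) - a (m - 1) ^ 2 * f k (m - 1))
            + b m * (γ k m - γ k (m - 1)) = 0
          linear_combination h2 - hflast m
        · rw [show χ (k + 1) = γ (k + 1) from if_neg hk']
          exact h2
      · rw [if_neg (by omega), if_pos le_rfl, if_pos le_rfl,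
          show χ k = γ k + f (k + 1) from if_pos rfl]
        funext m
        change 0 - 0 + 2 * (a m ^ 2 * f k (m + 1) - a (m - 1) ^ 2 * f k (m - 1))
          + b m * ((γ k m + f (k + 1) m) - (γ k (m - 1) + f (k + 1) (m - 1))) = 0
        have h1 := hst.stationary₁ (m - 1)
        rw [sub_add_cancel] at h1
        linear_combination 2 * hst.stationary₂ m - b m * h1
      · rw [if_neg (by omega), if_neg (by omega), if_neg (by omega)]
        simp
  have hrev : ∀ (s : ℕ → ℤ → ℂ) (m : ℤ),
      PowerSeries.map (Pi.evalRingHom (fun _ => ℂ) m) (truncSeries g s)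
        = revSeries g (coeffPoly (fun k => s k m) g) := by
    intro s m
    rw [map_truncSeries, revSeries_coeffPoly]
    rfl
  have hG : ∀ m, todaG g f γ m = coeffPoly (fun k => χ k m) g - X ^ (g + 1) := by
    intro m
    have : coeffPoly (fun k => χ k m) g
        = coeffPoly (fun k => γ k m) g + C (f (g + 1) m) := by
      simp only [coeffPoly, Finset.sum_range_succ', Nat.sub_zero, pow_zero, mul_one]
      rw [show χ g = γ g + f (g + 1) from if_pos rfl, Pi.add_apply, map_add, ← add_assoc]
      congr 2
      refine Finset.sum_congr rfl fun l _ => ?_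
      rw [show χ (g - (l + 1)) = γ (g - (l + 1)) from if_neg (by omega)]
    rw [todaG, this]
    ring
  have hGdeg : ∀ m, (todaG g f γ m).natDegree ≤ g + 1 := by
    intro m
    rw [hG]
    exact (natDegree_sub_le _ _).trans
      (max_le ((natDegree_coeffPoly_le _ _).trans (Nat.le_succ _)) (natDegree_X_pow_le _))
  have hGrev : ∀ m, revSeries (g + 1) (todaG g f γ m)
      = -1 + PowerSeries.X * revSeries g (coeffPoly (fun k => χ k m) g) := by
    intro m
    rw [hG, revSeries_sub, revSeries_succ (natDegree_coeffPoly_le _ _)]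
    have : revSeries (g + 1) (X ^ (g + 1)) = 1 := by
      rw [revSeries, reflect_monomial, revAt_le le_rfl, Nat.sub_self, pow_zero, Polynomial.coe_one]
    rw [this]
    ring
  have hRser : PowerSeries.map (Pi.evalRingHom (fun _ => ℂ) n₀)
      (todaForm (seqShift 1) a (truncSeries g f) (-1 + PowerSeries.X * truncSeries g χ))
      = branchSeries Finset.univ E := by
    have hshift : PowerSeries.map (Pi.evalRingHom (fun _ => ℂ) n₀)
        (PowerSeries.map (seqShift 1 : (ℤ → ℂ) →+* (ℤ → ℂ)) (truncSeries g f))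
        = revSeries g (coeffPoly (fun k => f k (n₀ + 1)) g) := by
      rw [map_truncSeries, hrev]
      rfl
    have dFF : (coeffPoly (fun k => f k n₀) g
        * coeffPoly (fun k => f k (n₀ + 1)) g).natDegree ≤ g + g :=
      natDegree_mul_le_of_le (natDegree_coeffPoly_le _ _) (natDegree_coeffPoly_le _ _)
    rw [← revSeries_prod_univ, ← hR, todaR, todaF, todaF, mul_assoc, revSeries_sub, revSeries_C_mul,
      pow_two, show 2 * g + 2 = g + g + 1 + 1 by ring, revSeries_succ (dFF.trans (Nat.le_succ _)),
      revSeries_succ dFF, revSeries_mul (natDegree_coeffPoly_le _ _) (natDegree_coeffPoly_le _ _),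
      show g + g + 1 + 1 = (g + 1) + (g + 1) by ring, revSeries_mul (hGdeg _) (hGdeg _), hGrev]
    simp only [todaForm, map_sub, map_add, map_neg, map_one, map_mul (PowerSeries.map _),
      PowerSeries.map_X, PowerSeries.map_C, hshift, hrev]
    rfl
  have hmain := todaHat_series hser
    (eq_map_algebraMap_of_shift (hser.map_todaForm_shift fun s => by
      funext m
      change s (m + -1 + 1) = s m
      rw [neg_add_cancel_right]) hRser) n
  rw [map_truncSeries] at hmain
  have ht : truncSeries g (fun k => f k n) = PowerSeries.C 1 * branchSeries Finset.univ μ :=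
    truncSeries_eq_of_coeffPoly_eq (by rw [map_one, one_mul]; exact hF)
  have := eval_coeffPoly r j E μ 1 _ (hmain.trans (congrArg _ ht))
  rw [one_mul] at this
  exact this

end Hierarchies

end

theorem mainTheorem2 (g r : ℕ) (j : Fin g) :
    -- KdV
    (∀ (V : ℝ → ℂ) (f : ℕ → ℝ → ℂ) (E : Fin (2 * g + 1) → ℂ) (x₀ : ℝ),
      Hierarchies.IsStationaryKdV g V f →
      Hierarchies.kdvR g V f x₀ = ∏ m, (Polynomial.X - Polynomial.C (E m)) →
      ∀ (x : ℝ) (μ : Fin g → ℂ),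
        Hierarchies.kdvF g f x = ∏ l, (Polynomial.X - Polynomial.C (μ l)) →
        (Hierarchies.kdvFHat V r x).eval (μ j)
          = ∑ p ∈ Finset.Icc (r - g) r,
              Hierarchies.cCoeff p E * Hierarchies.Phi (r - p) j μ) ∧
    -- Toda
    (∀ (a b : ℤ → ℂ) (f γ : ℕ → ℤ → ℂ) (E : Fin (2 * g + 2) → ℂ) (n₀ : ℤ),
      Hierarchies.IsStationaryToda g a b f γ →
      Hierarchies.todaR g a f γ n₀ = ∏ m, (Polynomial.X - Polynomial.C (E m)) →
      ∀ (n : ℤ) (μ : Fin g → ℂ),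
        Hierarchies.todaF g f n = ∏ l, (Polynomial.X - Polynomial.C (μ l)) →
        (Hierarchies.todaFHat a b r n).eval (μ j)
          = ∑ p ∈ Finset.Icc (r - g) r,
              Hierarchies.cCoeff p E * Hierarchies.Phi (r - p) j μ) ∧
    -- AKNS
    (∀ (p q : ℝ → ℂ) (f γ h : ℕ → ℝ → ℂ) (E : Fin (2 * g + 2) → ℂ) (x₀ : ℝ),
      Hierarchies.IsStationaryAKNS g p q f γ h →
      Hierarchies.aknsR g f γ h x₀ = ∏ m, (Polynomial.X - Polynomial.C (E m)) →
      ∀ x : ℝ,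
        (∀ μ : Fin g → ℂ,
          Hierarchies.aknsF g f x
            = Polynomial.C (-Complex.I * q x) * ∏ l, (Polynomial.X - Polynomial.C (μ l)) →
          (Hierarchies.aknsFHat p q r x).eval (μ j)
            = -Complex.I * q x * ∑ k ∈ Finset.Icc (r - g) r,
                Hierarchies.cCoeff k E * Hierarchies.Phi (r - k) j μ) ∧
        (∀ ν : Fin g → ℂ,
          Hierarchies.aknsF g h x
            = Polynomial.C (Complex.I * p x) * ∏ l, (Polynomial.X - Polynomial.C (ν l)) →
          (Hierarchies.aknsHHat p q r x).eval (ν j)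
            = Complex.I * p x * ∑ k ∈ Finset.Icc (r - g) r,
                Hierarchies.cCoeff k E * Hierarchies.Phi (r - k) j ν)) ∧
    -- sGmKdV; `Finset.Ico (r - 1 - g) r` is the range `(r-1-g) ∨ 0 ≤ p ≤ r-1`, empty for `r = 0`
    (∀ (u : ℝ → ℂ) (α β : ℂ) (f h γ : ℕ → ℝ → ℂ) (E : Fin (2 * g + 1) → ℂ) (x₀ : ℝ),
      Hierarchies.IsStationarySG g u α β f h γ →
      Hierarchies.sgR g f h γ x₀ = ∏ m, (Polynomial.X - Polynomial.C (E m)) →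
      ∀ x : ℝ,
        (α ≠ 0 → ∀ (α' : ℂ) (μ : Fin g → ℂ),
          Hierarchies.sgF g f x = ∏ l, (Polynomial.X - Polynomial.C (μ l)) →
          μ j ≠ 0 ∧
          (Hierarchies.sgFHat u α' r x).eval (μ j) / μ j
            = ∑ p ∈ Finset.Ico (r - 1 - g) r,
                Hierarchies.cCoeff p E * Hierarchies.Phi (r - 1 - p) j μ
              - α' / α * Hierarchies.Phi (g - 1) j μ) ∧
        (β ≠ 0 → ∀ (β' : ℂ) (ν : Fin g → ℂ),
          Hierarchies.sgF g h x = ∏ l, (Polynomial.X - Polynomial.C (ν l)) →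
          ν j ≠ 0 ∧
          (Hierarchies.sgHHat u β' r x).eval (ν j) / ν j
            = ∑ p ∈ Finset.Ico (r - 1 - g) r,
                Hierarchies.cCoeff p E * Hierarchies.Phi (r - 1 - p) j ν
              - β' / β * Hierarchies.Phi (g - 1) j ν)) := by
  refine ⟨?_, ?_, ?_, ?_⟩
  · intro V f E x₀ hst hR x μ hF
    exact Hierarchies.kdv_eval r j V f E x₀ hst hR x μ hF
  · intro a b f γ E n₀ hst hR n μ hF
    exact Hierarchies.toda_eval r j a b f γ E n₀ hst hR n μ hF
  · intro p q f γ h E x₀ hst hR x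
    exact Hierarchies.akns_eval r j p q f γ h E x₀ hst hR x
  · intro u α β f h γ E x₀ hst hR x
    exact Hierarchies.sg_eval r j u α β f h γ E x₀ hst hR x
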